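/- Let $k$ be an algebraically closed field of characteristic zero and let $X\subseteq\mathbb{P}^N_k$ be a nonsingular projective variety (integral closed subvariety) of positive dimension. Put $\mathcal{L}=\mathcal{O}_X(1)$. Assume that $X$ is embedded by the complete linear system of $\mathcal{L}$, i.e. every global section of $\mathcal{L}$ is the restriction of a linear form on $\mathbb{P}^N$, and that $\mathcal{L}$ is $5$-very ample, i.e. for every zero-dimensional subscheme $Z\subseteq X$ of length at most $6$ the restriction map $H^0(X,\mathcal{L})\to H^0(X,\mathcal{L}\otimes\mathcal{O}_Z)$ is surjective. For $r\ge 1$ let $\sigma_r(X)\subseteq\mathbb{P}^N$ be the $r$-secant variety, the Zariski closure of the union of the linear subspaces spanned by $r$ points of $X$. Let $Y=\sigma_2(X)$, let $J=J(X,Y)=\operatorname{Proj}(S_X\otimes_k S_Y)$ be the ruled join, where $S_X$, $S_Y$ are the homogeneous coordinate rings of $X$, $Y$, and let $XY\subseteq\mathbb{P}^N$ be the embedded join, the Zariski closure of the union of the lines joining a point of $X$ to a point of $Y$. Then $XY=\sigma_3(X)$, and the dominant rational map $$J(X,Y)\dashrightarrow XY,\qquad [x_0:\dots:x_N:y_0:\dots:y_N]\mapsto[x_0-y_0:\dots:x_N-y_N],$$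 has degree $3$, i.e. $[k(J):k(XY)]=3$. -/

import Mathlib

open scoped LinearAlgebra.Projectivization TensorProduct

noncomputable section

/-! ## Function fields of graded domains and degrees of rational maps -/

namespace GradedDomain

variable {k R R' : Type*} [Field k] [CommRing R] [IsDomain R] [Algebra k R]
  [CommRing R'] [IsDomain R'] [Algebra k R']

/-- The function field of `Proj R`, for a graded domain `R = ⨁ 𝒜 n`: the field of the quotients
`a / b` of homogeneous elements of the same degree, inside the fraction field of `R`. -/
def functionField (𝒜 : ℕ → Submodule k R) [SetLike.GradedMonoid 𝒜] :
    Subfield (FractionRing R) where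
  carrier := {z | ∃ n, ∃ a ∈ 𝒜 n, ∃ b ∈ 𝒜 n, b ≠ 0 ∧
    z = algebraMap R (FractionRing R) a / algebraMap R (FractionRing R) b}
  one_mem' := ⟨0, 1, SetLike.GradedOne.one_mem, 1, SetLike.GradedOne.one_mem, one_ne_zero, by simp⟩
  zero_mem' := ⟨0, 0, zero_mem _, 1, SetLike.GradedOne.one_mem, one_ne_zero, by simp⟩
  mul_mem' := by
    rintro _ _ ⟨n, a, ha, b, hb, h0, rfl⟩ ⟨m, c, hc, d, hd, h1, rfl⟩
    refine ⟨n + m, a * c, SetLike.GradedMul.mul_mem ha hc, b * d,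
      SetLike.GradedMul.mul_mem hb hd, mul_ne_zero h0 h1, ?_⟩
    rw [map_mul, map_mul, div_mul_div_comm]
  add_mem' := by
    rintro _ _ ⟨n, a, ha, b, hb, h0, rfl⟩ ⟨m, c, hc, d, hd, h1, rfl⟩
    refine ⟨n + m, a * d + b * c, add_mem (SetLike.GradedMul.mul_mem ha hd)
      (SetLike.GradedMul.mul_mem hb hc), b * d, SetLike.GradedMul.mul_mem hb hd,
      mul_ne_zero h0 h1, ?_⟩
    rw [div_add_div _ _ (by simpa using h0) (by simpa using h1)]
    simp
  neg_mem' := by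
    rintro _ ⟨n, a, ha, b, hb, h0, rfl⟩
    exact ⟨n, -a, neg_mem ha, b, hb, h0, by simp [neg_div]⟩
  inv_mem' := by
    rintro _ ⟨n, a, ha, b, hb, h0, rfl⟩
    by_cases h : a = 0
    · exact ⟨0, 0, zero_mem _, 1, SetLike.GradedOne.one_mem, one_ne_zero, by simp [h]⟩
    · exact ⟨n, b, hb, a, ha, h, by simp⟩

variable (𝒜 : ℕ → Submodule k R) [SetLike.GradedMonoid 𝒜]
  (ℬ : ℕ → Submodule k R') [SetLike.GradedMonoid ℬ]

/-- The pull-back `a / b ↦ φ a / φ b` of rational functions along the dominant rational map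
`Proj R' ⇢ Proj R` given by an injective homomorphism `φ : R → R'` of graded domains. -/
def pullback (φ : R →ₐ[k] R') (hφ : Function.Injective φ) (hgr : ∀ n, ∀ a ∈ 𝒜 n, φ a ∈ ℬ n) :
    functionField 𝒜 →+* functionField ℬ :=
  ((IsFractionRing.map (K := FractionRing R) (L := FractionRing R') (j := φ.toRingHom) hφ).comp
    (functionField 𝒜).subtype).codRestrict (functionField ℬ).toSubring (by
      rintro ⟨_, n, a, ha, b, hb, h0, rfl⟩
      refine ⟨n, φ a, hgr n a ha, φ b, hgr n b hb, fun h => h0 (hφ (by simpa using h)), ?_⟩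
      simp [IsFractionRing.map])

/-- The degree of the dominant rational map `Proj R' ⇢ Proj R` given by an injective homomorphism
`φ : R → R'` of graded domains: the degree of the extension of function fields. (The value `0`
stands for an infinite extension.) -/
def rationalMapDegree (φ : R →ₐ[k] R') (hφ : Function.Injective φ)
    (hgr : ∀ n, ∀ a ∈ 𝒜 n, φ a ∈ ℬ n) : ℕ :=
  letI : Algebra (functionField 𝒜) (functionField ℬ) := (pullback 𝒜 ℬ φ hφ hgr).toAlgebra
  Module.finrank (functionField 𝒜) (functionField ℬ)

end GradedDomain

/-! ## Projective varieties -/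

section

attribute [local instance] MvPolynomial.gradedAlgebra

/-- A (nonempty, irreducible, reduced) closed subvariety of `ℙ^N`, given by its homogeneous prime
ideal, which is not to contain the irrelevant ideal. -/
structure ProjectiveVariety (k : Type*) [Field k] (N : ℕ) where
  ideal : Ideal (MvPolynomial (Fin (N + 1)) k)
  isHomogeneous : ideal.IsHomogeneous (MvPolynomial.homogeneousSubmodule (Fin (N + 1)) k)
  isPrime : ideal.IsPrime
  exists_X_notMem : ∃ i, MvPolynomial.X i ∉ ideal

end

namespace ProjectiveVariety

variable {k : Type*} [Field k] {N : ℕ}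

instance (X : ProjectiveVariety k N) : X.ideal.IsPrime := X.isPrime

/-- The `k`-points of the affine cone over `X`. -/
def cone (X : ProjectiveVariety k N) : Set (Fin (N + 1) → k) := MvPolynomial.zeroLocus k X.ideal

/-- The `k`-points of `X` in projective space. -/
def points (X : ProjectiveVariety k N) : Set (ℙ k (Fin (N + 1) → k)) := {p | p.rep ∈ X.cone}

/-- The homogeneous coordinate ring. -/
def coordRing (X : ProjectiveVariety k N) : Type _ := MvPolynomial (Fin (N + 1)) k ⧸ X.ideal

instance (X : ProjectiveVariety k N) : CommRing X.coordRing :=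
  inferInstanceAs (CommRing (MvPolynomial (Fin (N + 1)) k ⧸ X.ideal))

instance (X : ProjectiveVariety k N) : Algebra k X.coordRing :=
  inferInstanceAs (Algebra k (MvPolynomial (Fin (N + 1)) k ⧸ X.ideal))

instance (X : ProjectiveVariety k N) : IsDomain X.coordRing :=
  inferInstanceAs (IsDomain (MvPolynomial (Fin (N + 1)) k ⧸ X.ideal))

/-- The quotient map from the polynomial ring to the homogeneous coordinate ring. -/
def toCoordRing (X : ProjectiveVariety k N) : MvPolynomial (Fin (N + 1)) k →ₐ[k] X.coordRing :=
  Ideal.Quotient.mkₐ k X.ideal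

theorem toCoordRing_surjective (X : ProjectiveVariety k N) : Function.Surjective X.toCoordRing :=
  Ideal.Quotient.mk_surjective

theorem toCoordRing_eq_zero_iff (X : ProjectiveVariety k N) (f : MvPolynomial (Fin (N + 1)) k) :
    X.toCoordRing f = 0 ↔ f ∈ X.ideal := Ideal.Quotient.eq_zero_iff_mem

/-- The homogeneous elements of degree `n` of the homogeneous coordinate ring. -/
def piece (X : ProjectiveVariety k N) (n : ℕ) : Submodule k X.coordRing :=
  (MvPolynomial.homogeneousSubmodule (Fin (N + 1)) k n).map X.toCoordRing.toLinearMap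

instance (X : ProjectiveVariety k N) : SetLike.GradedMonoid X.piece where
  one_mem := ⟨1, MvPolynomial.isHomogeneous_one _ _, by simp⟩
  mul_mem := by
    rintro i j _ _ ⟨a, ha, rfl⟩ ⟨b, hb, rfl⟩
    exact ⟨a * b, MvPolynomial.IsHomogeneous.mul ha hb, by simp⟩

/-- The coordinate functions `x_i` on the cone over `X`. -/
def coord (X : ProjectiveVariety k N) (i : Fin (N + 1)) : X.coordRing :=
  X.toCoordRing (MvPolynomial.X i)

/-! ### Sections of `𝒪_X(1)`, nonsingularity, and higher very ampleness -/

/-- The ring of regular functions on the affine open set `D(h) ⊆ X` where the linear form `h ≠ 0`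
does not vanish, as a subring of the fraction field of the homogeneous coordinate ring:
it consists of the fractions `f / h ^ m` with `f` homogeneous of degree `m`. -/
def chartRing (X : ProjectiveVariety k N) (h : X.piece 1) :
    Subalgebra k (FractionRing X.coordRing) where
  carrier := {z | ∃ m, ∃ f ∈ X.piece m, z * algebraMap _ _ (h : X.coordRing) ^ m =
    algebraMap X.coordRing (FractionRing X.coordRing) f}
  mul_mem' := by
    rintro a b ⟨m, f, hf, e⟩ ⟨n, g, hg, e'⟩
    refine ⟨m + n, f * g, SetLike.GradedMul.mul_mem hf hg, ?_⟩
    rw [map_mul, ← e, ← e']; ring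
  add_mem' := by
    rintro a b ⟨m, f, hf, e⟩ ⟨n, g, hg, e'⟩
    have hp : ∀ r : ℕ, (h : X.coordRing) ^ r ∈ X.piece r := fun r => by
      simpa using SetLike.pow_mem_graded r h.2
    refine ⟨m + n, f * (h : X.coordRing) ^ n + (h : X.coordRing) ^ m * g,
      add_mem (SetLike.GradedMul.mul_mem hf (hp n)) (SetLike.GradedMul.mul_mem (hp m) hg), ?_⟩
    rw [map_add, map_mul, map_mul, map_pow, map_pow, ← e, ← e']; ring
  algebraMap_mem' r := by
    refine ⟨0, algebraMap k X.coordRing r, ?_, ?_⟩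
    · rw [Algebra.algebraMap_eq_smul_one]
      exact Submodule.smul_mem _ _ SetLike.GradedOne.one_mem
    · rw [pow_zero, mul_one, ← IsScalarTower.algebraMap_apply]

/-- `X` is nonsingular: all its local rings, that is, the localizations of the rings of regular
functions on the affine open sets `D(h)` at prime ideals, are regular. -/
def IsNonsingular (X : ProjectiveVariety k N) : Prop :=
  ∀ h : X.piece 1, h ≠ 0 → IsRegularRing (X.chartRing h)

/-- The space `H⁰(X, 𝒪_X(1))` of global sections: the `s` in the fraction field of the
homogeneous coordinate ring such that `s / h` is a regular function on `D(h)` for each linear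
form `h ≠ 0` (on `D(h)`, the line bundle `𝒪_X(1)` is free with basis `h`). -/
def sections (X : ProjectiveVariety k N) : Submodule k (FractionRing X.coordRing) where
  carrier := {s | ∀ h : X.piece 1, h ≠ 0 →
    s / algebraMap X.coordRing (FractionRing X.coordRing) h ∈ X.chartRing h}
  add_mem' {a b} ha hb h h0 := by rw [add_div]; exact add_mem (ha h h0) (hb h h0)
  zero_mem' h _ := by rw [zero_div]; exact zero_mem _
  smul_mem' c s hs h h0 := by
    rw [smul_div_assoc]; exact Subalgebra.smul_mem _ (hs h h0) c

/-- The embedding `X ⊆ ℙ^N` is given by the complete linear system of `𝒪_X(1)`: every global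
section of `𝒪_X(1)` is the restriction of a linear form. -/
def IsCompletelyEmbedded (X : ProjectiveVariety k N) : Prop :=
  ∀ s ∈ X.sections, ∃ l ∈ X.piece 1, s = algebraMap X.coordRing (FractionRing X.coordRing) l

/-- The restriction of global sections of `𝒪_X(1)` to a closed subscheme `Z` of `D(h)` given by
an ideal `J` of the ring of regular functions on `D(h)`. The sections of `𝒪_X(1) ⊗ 𝒪_Z` are
identified with the elements of `𝒪(D(h)) ⧸ J` through the basis `h` of `𝒪_X(1)` on `D(h)`. -/
def restrict (X : ProjectiveVariety k N) (h : X.piece 1) (h0 : h ≠ 0)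
    (J : Ideal (X.chartRing h)) : X.sections →ₗ[k] X.chartRing h ⧸ J :=
  (Ideal.Quotient.mkₐ k J).toLinearMap ∘ₗ
    { toFun := fun s => ⟨(s : FractionRing X.coordRing) /
        algebraMap X.coordRing (FractionRing X.coordRing) h, s.2 h h0⟩
      map_add' := fun _ _ => Subtype.ext (add_div _ _ _)
      map_smul' := fun _ _ => Subtype.ext (smul_div_assoc _ _ _) }

/-- `𝒪_X(1)` is `d`-very ample: for every zero-dimensional subscheme `Z` of `X` of length at most
`d + 1`, the restriction map `H⁰(X, 𝒪_X(1)) → H⁰(X, 𝒪_X(1) ⊗ 𝒪_Z)` is surjective. (The field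
being infinite, each such `Z` lies in some `D(h)`, so that it is given by an ideal of finite
codimension in the ring of regular functions on `D(h)`.) -/
def IsVeryAmple (X : ProjectiveVariety k N) (d : ℕ) : Prop :=
  ∀ (h : X.piece 1) (h0 : h ≠ 0) (J : Ideal (X.chartRing h)),
    Module.Finite k (X.chartRing h ⧸ J) → Module.finrank k (X.chartRing h ⧸ J) ≤ d + 1 →
      Function.Surjective (X.restrict h h0 J)

/-! ### Joins and secant varieties -/

/-- The ideal of all polynomials that vanish at (all representatives of) the points of `T`; it
defines the Zariski closure of `T`. -/
def vanishingIdeal (T : Set (ℙ k (Fin (N + 1) → k))) : Ideal (MvPolynomial (Fin (N + 1)) k) :=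
  MvPolynomial.vanishingIdeal k {v | ∃ hv : v ≠ 0, Projectivization.mk k v hv ∈ T}

/-- The union of the linear subspaces of `ℙ^N` spanned by points `p i ∈ X i`. -/
def spans {ι : Type*} (X : ι → ProjectiveVariety k N) : Set (ℙ k (Fin (N + 1) → k)) :=
  {q | ∃ p : ι → ℙ k (Fin (N + 1) → k), (∀ i, p i ∈ (X i).points) ∧
    q.submodule ≤ ⨆ i, (p i).submodule}

section Helpers

theorem aeval_smul_of_isHomogeneous {f : MvPolynomial (Fin (N + 1)) k} {n : ℕ}
    (hf : f.IsHomogeneous n) (c : k) (v : Fin (N + 1) → k) :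
    MvPolynomial.aeval (c • v) f = c ^ n * MvPolynomial.aeval v f := by
  rw [MvPolynomial.aeval_def, MvPolynomial.aeval_def, MvPolynomial.eval₂_eq,
    MvPolynomial.eval₂_eq, Finset.mul_sum]
  refine Finset.sum_congr rfl fun d hd => ?_
  have : ∑ i ∈ d.support, d i = n := by
    have := hf (MvPolynomial.mem_support_iff.1 hd)
    simpa [Finsupp.weight_apply, Finsupp.sum] using this
  simp only [Pi.smul_apply, smul_eq_mul, mul_pow, Finset.prod_mul_distrib]
  rw [Finset.prod_pow_eq_pow_sum, this]
  ring

theorem smul_mem_cone (X : ProjectiveVariety k N) (c : k) {v : Fin (N + 1) → k}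
    (hv : v ∈ X.cone) : c • v ∈ X.cone := by
  intro f hf
  rw [← MvPolynomial.sum_homogeneousComponent f, map_sum]
  refine Finset.sum_eq_zero fun n _ => ?_
  rw [aeval_smul_of_isHomogeneous (MvPolynomial.homogeneousComponent_isHomogeneous n f)]
  rw [hv _ (MvPolynomial.homogeneousComponent_mem_of_mem X.isHomogeneous hf n), mul_zero]

theorem mk_mem_points (X : ProjectiveVariety k N) {v : Fin (N + 1) → k} (hv : v ∈ X.cone)
    (h0 : v ≠ 0) : Projectivization.mk k v h0 ∈ X.points := by
  obtain ⟨a, ha⟩ := Projectivization.exists_smul_eq_mk_rep k v h0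
  change (Projectivization.mk k v h0).rep ∈ X.cone
  rw [← ha]
  exact X.smul_mem_cone _ hv

variable [IsAlgClosed k]

theorem mem_ideal_iff (X : ProjectiveVariety k N) (f : MvPolynomial (Fin (N + 1)) k) :
    f ∈ X.ideal ↔ ∀ v ∈ X.cone, MvPolynomial.aeval v f = 0 := by
  have := MvPolynomial.vanishingIdeal_zeroLocus_eq_radical (K := k) X.ideal
  rw [X.isPrime.radical] at this
  conv_lhs => rw [← this]
  rfl

theorem exists_cone_ne_zero (X : ProjectiveVariety k N) : ∃ v ∈ X.cone, v ≠ 0 := by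
  obtain ⟨i, hi⟩ := X.exists_X_notMem
  rw [mem_ideal_iff] at hi
  push Not at hi
  obtain ⟨v, hv, h⟩ := hi
  exact ⟨v, hv, fun h' => h (by simp [h'])⟩

theorem exists_common (X : ProjectiveVariety k N) (u w : Fin (N + 1) → k)
    (f g : MvPolynomial (Fin (N + 1)) k)
    (hf : ∃ v ∈ X.cone, MvPolynomial.aeval (v + u) f ≠ 0)
    (hg : ∃ v ∈ X.cone, MvPolynomial.aeval (v + w) g ≠ 0) :
    ∃ v ∈ X.cone, MvPolynomial.aeval (v + u) f ≠ 0 ∧ MvPolynomial.aeval (v + w) g ≠ 0 := by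
  have key : ∀ (t : Fin (N + 1) → k) (p : MvPolynomial (Fin (N + 1)) k) (v : Fin (N + 1) → k),
      MvPolynomial.aeval v (MvPolynomial.aeval
        (fun i => MvPolynomial.X i + MvPolynomial.C (t i)) p) = MvPolynomial.aeval (v + t) p := by
    intro t p v
    rw [← AlgHom.comp_apply]
    congr 1
    ext i
    simp
  by_contra! hcon
  have : MvPolynomial.aeval (fun i => MvPolynomial.X i + MvPolynomial.C (u i)) f *
      MvPolynomial.aeval (fun i => MvPolynomial.X i + MvPolynomial.C (w i)) g ∈ X.ideal := by
    rw [mem_ideal_iff]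
    intro v hv
    rw [map_mul, key, key]
    by_cases h : MvPolynomial.aeval (v + u) f = 0
    · simp [h]
    · simp [hcon v hv h]
  rcases X.isPrime.mem_or_mem this with h | h <;> rw [mem_ideal_iff] at h
  · obtain ⟨v, hv, h'⟩ := hf
    exact h' (by rw [← key]; exact h v hv)
  · obtain ⟨v, hv, h'⟩ := hg
    exact h' (by rw [← key]; exact h v hv)

theorem exists_common_sum {ι : Type*} (s : Finset ι) (X : ι → ProjectiveVariety k N)
    (f g : MvPolynomial (Fin (N + 1)) k) (a b : ι → Fin (N + 1) → k)
    (ha : ∀ i, a i ∈ (X i).cone) (hb : ∀ i, b i ∈ (X i).cone) (u w : Fin (N + 1) → k)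
    (hf : MvPolynomial.aeval (∑ i ∈ s, a i + u) f ≠ 0)
    (hg : MvPolynomial.aeval (∑ i ∈ s, b i + w) g ≠ 0) :
    ∃ c : ι → Fin (N + 1) → k, (∀ i, c i ∈ (X i).cone) ∧
      MvPolynomial.aeval (∑ i ∈ s, c i + u) f ≠ 0 ∧
      MvPolynomial.aeval (∑ i ∈ s, c i + w) g ≠ 0 := by
  classical
  induction s using Finset.induction_on generalizing u w with
  | empty => exact ⟨a, ha, by simpa using hf, by simpa using hg⟩
  | insert j s hj ih =>
    rw [Finset.sum_insert hj, add_assoc] at hf hg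
    obtain ⟨v, hv, h1, h2⟩ := (X j).exists_common (∑ i ∈ s, a i + u) (∑ i ∈ s, b i + w) f g
      ⟨_, ha j, hf⟩ ⟨_, hb j, hg⟩
    obtain ⟨c, hc, h3, h4⟩ := ih (v + u) (v + w) (by rwa [add_left_comm])
      (by rwa [add_left_comm])
    refine ⟨Function.update c j v, fun i => ?_, ?_⟩
    · by_cases h : i = j
      · subst h; simpa using hv
      · simpa [h] using hc i
    · have e : ∑ i ∈ s, Function.update c j v i = ∑ i ∈ s, c i :=
        Finset.sum_congr rfl fun i hi => by
          rw [Function.update_of_ne]; rintro rfl; exact hj hi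
      rw [Finset.sum_insert hj, e, Function.update_self, add_assoc, add_assoc,
        add_left_comm, add_left_comm v]
      exact ⟨h3, h4⟩


theorem mk_mem_spans_iff {ι : Type*} [Fintype ι] (X : ι → ProjectiveVariety k N)
    {v : Fin (N + 1) → k} (hv : v ≠ 0) : Projectivization.mk k v hv ∈ spans X ↔
      ∃ c : ι → Fin (N + 1) → k, (∀ i, c i ∈ (X i).cone) ∧ v = ∑ i, c i := by
  classical
  constructor
  · rintro ⟨p, hp, h⟩
    rw [Projectivization.submodule_mk, Submodule.span_singleton_le_iff_mem,
      Submodule.mem_iSup_iff_exists_finsupp] at h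
    obtain ⟨f, hf, rfl⟩ := h
    refine ⟨f, fun i => ?_, Finsupp.sum_fintype _ _ (by simp)⟩
    have := hf i
    rw [Projectivization.submodule_eq, Submodule.mem_span_singleton] at this
    obtain ⟨a, ha⟩ := this
    rw [← ha]
    exact (X i).smul_mem_cone _ (hp i)
  · rintro ⟨c, hc, e⟩
    choose u hu hu0 using fun i => (X i).exists_cone_ne_zero
    have hex : ∀ i, ∃ p ∈ (X i).points, c i ∈ p.submodule := fun i => by
      by_cases h : c i = 0
      · exact ⟨_, (X i).mk_mem_points (hu i) (hu0 i), by simp [h]⟩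
      · refine ⟨_, (X i).mk_mem_points (hc i) h, ?_⟩
        rw [Projectivization.submodule_mk]
        exact Submodule.mem_span_singleton_self _
    choose p hp hcp using hex
    refine ⟨p, hp, ?_⟩
    rw [Projectivization.submodule_mk, Submodule.span_singleton_le_iff_mem, e]
    exact Submodule.sum_mem _ fun i _ => Submodule.mem_iSup_of_mem i (hcp i)

theorem mem_vanishingIdeal_spans_iff {ι : Type*} [Fintype ι] (X : ι → ProjectiveVariety k N)
    (f : MvPolynomial (Fin (N + 1)) k) : f ∈ vanishingIdeal (spans X) ↔
      ∀ c : ι → Fin (N + 1) → k, (∀ i, c i ∈ (X i).cone) → ∑ i, c i ≠ 0 →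
        MvPolynomial.aeval (∑ i, c i) f = 0 := by
  constructor
  · exact fun h c hc h0 => h _ ⟨h0, (mk_mem_spans_iff X h0).2 ⟨c, hc, rfl⟩⟩
  · rintro h v ⟨h0, hv⟩
    obtain ⟨c, hc, rfl⟩ := (mk_mem_spans_iff X h0).1 hv
    exact h c hc h0

theorem exists_sum_ne_zero {ι : Type*} [Fintype ι] [Nonempty ι] (X : ι → ProjectiveVariety k N) :
    ∃ c : ι → Fin (N + 1) → k, (∀ i, c i ∈ (X i).cone) ∧ ∑ i, c i ≠ 0 := by
  classical
  obtain ⟨j⟩ := ‹Nonempty ι›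
  obtain ⟨v, hv, h0⟩ := (X j).exists_cone_ne_zero
  refine ⟨Pi.single j v, fun i => ?_, by simpa [Finset.sum_pi_single'] using h0⟩
  by_cases h : i = j
  · subst h; simpa using hv
  · obtain ⟨w, hw, _⟩ := (X i).exists_cone_ne_zero
    simpa [h] using (X i).smul_mem_cone 0 hw

attribute [local instance] MvPolynomial.gradedAlgebra in
theorem vanishingIdeal_isHomogeneous (T : Set (ℙ k (Fin (N + 1) → k))) :
    (vanishingIdeal T).IsHomogeneous (MvPolynomial.homogeneousSubmodule (Fin (N + 1)) k) := by
  intro n f hf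
  change (MvPolynomial.decomposition.decompose' f n : MvPolynomial (Fin (N + 1)) k) ∈ _
  rw [MvPolynomial.decomposition.decompose'_apply]
  rintro v ⟨hv, hT⟩
  set q : Polynomial k := ∑ m ∈ Finset.range (f.totalDegree + 1),
    Polynomial.monomial m (MvPolynomial.aeval v (MvPolynomial.homogeneousComponent m f)) with hq
  have hq0 : q = 0 := by
    refine Polynomial.eq_zero_of_infinite_isRoot _
      (Set.Infinite.mono ?_ (Set.finite_singleton (0 : k)).infinite_compl)
    intro c hc
    have hc' : c ≠ 0 := hc
    have h1 : MvPolynomial.aeval (c • v) f = 0 := by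
      refine hf _ ⟨smul_ne_zero hc' hv, ?_⟩
      rwa [(Projectivization.mk_eq_mk_iff' k (c • v) v (smul_ne_zero hc' hv) hv).2 ⟨c, rfl⟩]
    rw [← MvPolynomial.sum_homogeneousComponent f, map_sum] at h1
    simp only [Set.mem_ofPred_eq, Polynomial.IsRoot, hq, Polynomial.eval_finsetSum,
      Polynomial.eval_monomial]
    rw [← h1]
    refine Finset.sum_congr rfl fun m _ => ?_
    rw [aeval_smul_of_isHomogeneous (MvPolynomial.homogeneousComponent_isHomogeneous m f),
      mul_comm]
  by_cases hn : n < f.totalDegree + 1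
  · have := congrArg (Polynomial.coeff · n) hq0
    simpa [hq, Polynomial.finsetSum_coeff, Polynomial.coeff_monomial, hn] using this
  · rw [MvPolynomial.homogeneousComponent_eq_zero _ _ (by omega), map_zero]

theorem vanishingIdeal_spans_isPrime {ι : Type*} [Fintype ι] [Nonempty ι]
    (X : ι → ProjectiveVariety k N) : (vanishingIdeal (spans X)).IsPrime := by
  have key : ∀ f, f ∉ vanishingIdeal (spans X) → ∃ c : ι → Fin (N + 1) → k,
      (∀ i, c i ∈ (X i).cone) ∧ ∃ j, MvPolynomial.aeval (∑ i, c i + 0)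
        (f * MvPolynomial.X j) ≠ 0 := by
    intro f hf
    rw [mem_vanishingIdeal_spans_iff] at hf
    push Not at hf
    obtain ⟨c, hc, h0, h⟩ := hf
    obtain ⟨j, hj⟩ := Function.ne_iff.1 h0
    exact ⟨c, hc, j, by simpa using ⟨h, by simpa using hj⟩⟩
  refine ⟨fun h => ?_, fun {f g} hfg => ?_⟩
  · obtain ⟨c, hc, h0⟩ := exists_sum_ne_zero X
    have h1 : (1 : MvPolynomial (Fin (N + 1)) k) ∈ vanishingIdeal (spans X) := by
      rw [h]; trivial
    rw [mem_vanishingIdeal_spans_iff] at h1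
    simpa using h1 c hc h0
  · by_contra! hcon
    obtain ⟨a, ha, i, hi⟩ := key f hcon.1
    obtain ⟨b, hb, j, hj⟩ := key g hcon.2
    obtain ⟨c, hc, h1, h2⟩ := exists_common_sum Finset.univ X _ _ a b ha hb 0 0 hi hj
    rw [add_zero, map_mul] at h1 h2
    rw [mem_vanishingIdeal_spans_iff] at hfg
    have h0 : ∑ i, c i ≠ 0 := fun h => by simp [h] at h1
    have := hfg c hc h0
    rw [map_mul] at this
    rcases mul_eq_zero.1 this with h | h
    · exact left_ne_zero_of_mul h1 h
    · exact left_ne_zero_of_mul h2 h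

end Helpers

section RuledJoin

/-! ### The ruled join -/

/-- The homogeneous coordinate ring of the ruled join `J(X, Y)`: the tensor product of the
homogeneous coordinate rings of `X` and `Y`. -/
abbrev RuledJoinRing (X Y : ProjectiveVariety k N) : Type _ := X.coordRing ⊗[k] Y.coordRing

/-- Evaluation at a point of the cone. -/
def evalAt (X : ProjectiveVariety k N) (v : X.cone) : X.coordRing →ₐ[k] k :=
  Ideal.Quotient.liftₐ X.ideal (MvPolynomial.aeval (v : Fin (N + 1) → k)) fun f hf => v.2 f hf

@[simp]
theorem evalAt_toCoordRing (X : ProjectiveVariety k N) (v : X.cone) (f : MvPolynomial (Fin (N + 1)) k) :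
    X.evalAt v (X.toCoordRing f) = MvPolynomial.aeval v.1 f := rfl

/-- Partial evaluation of the coordinate ring of the ruled join, in the first variables. -/
def evalLeft (X Y : ProjectiveVariety k N) (v : X.cone) : RuledJoinRing X Y →ₐ[k] Y.coordRing :=
  Algebra.TensorProduct.lift ((Algebra.ofId k Y.coordRing).comp (X.evalAt v)) (AlgHom.id k _)
    fun _ _ => Commute.all _ _

/-- Partial evaluation of the coordinate ring of the ruled join, in the second variables. -/
def evalRight (X Y : ProjectiveVariety k N) (w : Y.cone) : RuledJoinRing X Y →ₐ[k] X.coordRing :=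
  Algebra.TensorProduct.lift (AlgHom.id k _) ((Algebra.ofId k X.coordRing).comp (Y.evalAt w))
    fun _ _ => Commute.all _ _

theorem eval_comm (X Y : ProjectiveVariety k N) (v : X.cone) (w : Y.cone)
    (t : RuledJoinRing X Y) :
    Y.evalAt w (evalLeft X Y v t) = X.evalAt v (evalRight X Y w t) := by
  rw [← AlgHom.comp_apply, ← AlgHom.comp_apply]
  congr 1
  apply Algebra.TensorProduct.ext'
  intro a b
  simp [evalLeft, evalRight, Algebra.ofId_apply]

end RuledJoin

section Joins

variable [IsAlgClosed k]

/-- The closure in `ℙ^N` of the union of all linear subspaces spanned by points `p i ∈ X i`. -/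
def joinOfFamily {ι : Type*} [Fintype ι] [Nonempty ι] (X : ι → ProjectiveVariety k N) :
    ProjectiveVariety k N where
  ideal := vanishingIdeal (spans X)
  isHomogeneous := vanishingIdeal_isHomogeneous _
  isPrime := vanishingIdeal_spans_isPrime X
  exists_X_notMem := by
    obtain ⟨c, hc, h0⟩ := exists_sum_ne_zero X
    obtain ⟨j, hj⟩ := Function.ne_iff.1 h0
    refine ⟨j, fun h => hj ?_⟩
    rw [mem_vanishingIdeal_spans_iff] at h
    simpa using h c hc h0

/-- The embedded join `XY`: the closure of the union of the lines joining a point of `X` to a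
point of `Y`. -/
def embeddedJoin (X Y : ProjectiveVariety k N) : ProjectiveVariety k N := joinOfFamily ![X, Y]

/-- The `r`-secant variety `σ_r(X)`: the closure of the union of the linear subspaces spanned by
`r` points of `X`. -/
def secantVariety (X : ProjectiveVariety k N) (r : ℕ) [NeZero r] : ProjectiveVariety k N :=
  joinOfFamily fun _ : Fin r => X

theorem eq_zero_of_evalAt (X : ProjectiveVariety k N) (a : X.coordRing)
    (h : ∀ v, X.evalAt v a = 0) : a = 0 := by
  obtain ⟨f, rfl⟩ := toCoordRing_surjective _ a
  rw [toCoordRing_eq_zero_iff, mem_ideal_iff]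
  exact fun v hv => h ⟨v, hv⟩

theorem eq_zero_of_evalLeft (X Y : ProjectiveVariety k N) (t : RuledJoinRing X Y)
    (h : ∀ v, evalLeft X Y v t = 0) : t = 0 := by
  classical
  obtain ⟨c, rfl⟩ := TensorProduct.eq_repr_basis_right (Module.Basis.ofVectorSpace k Y.coordRing) t
  suffices c = 0 by simp [this]
  ext i
  refine X.eq_zero_of_evalAt _ fun v => ?_
  have hv := h v
  rw [Finsupp.sum, map_sum] at hv
  have e : ∀ j, evalLeft X Y v (c j ⊗ₜ Module.Basis.ofVectorSpace k Y.coordRing j) =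
      X.evalAt v (c j) • Module.Basis.ofVectorSpace k Y.coordRing j := fun j => by
    simp [evalLeft, Algebra.ofId_apply, Algebra.smul_def]
  simp only [e] at hv
  by_cases hi : i ∈ c.support
  · exact linearIndependent_iff'.1 (Module.Basis.ofVectorSpace k Y.coordRing).linearIndependent
      _ _ hv i hi
  · rw [Finsupp.notMem_support_iff.1 hi, map_zero]

theorem eq_zero_of_eval (X Y : ProjectiveVariety k N) (t : RuledJoinRing X Y)
    (h : ∀ v w, Y.evalAt w (evalLeft X Y v t) = 0) : t = 0 :=
  eq_zero_of_evalLeft X Y t fun v => Y.eq_zero_of_evalAt _ (h v)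

/-- The ruled join is integral. -/
instance (X Y : ProjectiveVariety k N) : IsDomain (RuledJoinRing X Y) := by
  have hnt : Nontrivial (RuledJoinRing X Y) := by
    obtain ⟨v, hv, _⟩ := X.exists_cone_ne_zero
    exact (evalLeft X Y ⟨v, hv⟩).toRingHom.domain_nontrivial
  have : NoZeroDivisors (RuledJoinRing X Y) := by
    refine ⟨fun {s t} hst => ?_⟩
    by_contra! hcon
    have h1 : ∃ v w, Y.evalAt w (evalLeft X Y v s) ≠ 0 := by
      by_contra! h; exact hcon.1 (eq_zero_of_eval X Y s h)
    have h2 : ∃ v w, Y.evalAt w (evalLeft X Y v t) ≠ 0 := by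
      by_contra! h; exact hcon.2 (eq_zero_of_eval X Y t h)
    obtain ⟨v, w, h1⟩ := h1
    obtain ⟨v', w', h2⟩ := h2
    rw [eval_comm] at h1 h2
    have h3 : ∃ u, X.evalAt u (evalRight X Y w s * evalRight X Y w' t) ≠ 0 := by
      by_contra! h
      have h' : evalRight X Y w s * evalRight X Y w' t = 0 := X.eq_zero_of_evalAt _ h
      rcases mul_eq_zero.1 h' with h | h
      · exact h1 (by rw [h, map_zero])
      · exact h2 (by rw [h, map_zero])
    obtain ⟨u, hu⟩ := h3
    rw [map_mul, ← eval_comm, ← eval_comm] at hu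
    have h4 : evalLeft X Y u s * evalLeft X Y u t = 0 := by rw [← map_mul, hst, map_zero]
    rcases mul_eq_zero.1 h4 with h | h
    · exact left_ne_zero_of_mul hu (by rw [h, map_zero])
    · exact right_ne_zero_of_mul hu (by rw [h, map_zero])
  exact NoZeroDivisors.to_isDomain _

/-- The elements of (total) degree `n` of the homogeneous coordinate ring of the ruled join. -/
def ruledJoinPiece (X Y : ProjectiveVariety k N) (n : ℕ) : Submodule k (RuledJoinRing X Y) :=
  Submodule.span k {t | ∃ i j, i + j = n ∧ ∃ a ∈ X.piece i, ∃ b ∈ Y.piece j, t = a ⊗ₜ b}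

instance (X Y : ProjectiveVariety k N) : SetLike.GradedMonoid (ruledJoinPiece X Y) where
  one_mem := Submodule.subset_span
    ⟨0, 0, rfl, 1, SetLike.GradedOne.one_mem, 1, SetLike.GradedOne.one_mem, rfl⟩
  mul_mem := by
    intro m n s t hs ht
    have hst : s * t ∈ ruledJoinPiece X Y m * ruledJoinPiece X Y n := Submodule.mul_mem_mul hs ht
    rw [ruledJoinPiece, ruledJoinPiece, Submodule.span_mul_span] at hst
    refine Submodule.span_mono ?_ hst
    rintro _ ⟨_, ⟨i, j, rfl, a, ha, b, hb, rfl⟩, _, ⟨i', j', rfl, a', ha', b', hb', rfl⟩, rfl⟩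
    exact ⟨i + i', j + j', by omega, a * a', SetLike.GradedMul.mul_mem ha ha', b * b',
      SetLike.GradedMul.mul_mem hb hb', by simp⟩

/-- The ring homomorphism `f ↦ f(x_0 - y_0, …, x_N - y_N)`. -/
def substDiff (X Y : ProjectiveVariety k N) :
    MvPolynomial (Fin (N + 1)) k →ₐ[k] RuledJoinRing X Y :=
  MvPolynomial.aeval fun i => X.coord i ⊗ₜ[k] 1 - 1 ⊗ₜ[k] Y.coord i

theorem eval_substDiff (X Y : ProjectiveVariety k N) (v : X.cone) (w : Y.cone)
    (f : MvPolynomial (Fin (N + 1)) k) : Y.evalAt w (evalLeft X Y v (substDiff X Y f)) =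
      MvPolynomial.aeval (v.1 - w.1) f := by
  rw [← AlgHom.comp_apply, ← AlgHom.comp_apply]
  congr 1
  ext i
  simp [substDiff, evalLeft, coord, Algebra.ofId_apply]

theorem substDiff_eq_zero_iff (X Y : ProjectiveVariety k N) (f : MvPolynomial (Fin (N + 1)) k) :
    substDiff X Y f = 0 ↔ f ∈ (embeddedJoin X Y).ideal := by
  have hneg : ∀ w ∈ Y.cone, -w ∈ Y.cone := fun w hw => by
    simpa using Y.smul_mem_cone (-1) hw
  constructor
  · intro h
    refine (mem_vanishingIdeal_spans_iff _ f).2 fun c hc _ => ?_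
    have := eval_substDiff X Y ⟨c 0, hc 0⟩ ⟨-c 1, hneg _ (hc 1)⟩ f
    rw [h, map_zero, map_zero] at this
    rw [Fin.sum_univ_two, this]
    simp
  · intro h
    refine eq_zero_of_eval X Y _ fun v w => ?_
    rw [eval_substDiff]
    by_cases h0 : v.1 - w.1 = 0
    · obtain ⟨u, hu, _⟩ := (embeddedJoin X Y).exists_cone_ne_zero
      rw [h0, ← zero_smul k u]
      exact (embeddedJoin X Y).smul_mem_cone 0 hu f h
    · have := (mem_vanishingIdeal_spans_iff _ f).1 h ![v.1, -w.1]
      simp only [Fin.sum_univ_two, Fin.forall_fin_two] at this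
      simpa [sub_eq_add_neg] using this ⟨v.2, hneg _ w.2⟩ (by simpa [sub_eq_add_neg] using h0)

/-- The homomorphism `f ↦ f(x_0 - y_0, …, x_N - y_N)` of homogeneous coordinate rings that gives
the rational map `J(X, Y) ⇢ XY`, `[x : y] ↦ [x_0 - y_0 : … : x_N - y_N]`. -/
def additionMap (X Y : ProjectiveVariety k N) :
    (embeddedJoin X Y).coordRing →ₐ[k] RuledJoinRing X Y :=
  Ideal.Quotient.liftₐ (embeddedJoin X Y).ideal (substDiff X Y)
    fun f hf => (substDiff_eq_zero_iff X Y f).2 hf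

theorem additionMap_injective (X Y : ProjectiveVariety k N) :
    Function.Injective (additionMap X Y) := by
  rw [injective_iff_map_eq_zero]
  intro a ha
  obtain ⟨f, rfl⟩ := toCoordRing_surjective _ a
  rw [toCoordRing_eq_zero_iff, ← substDiff_eq_zero_iff]
  exact ha

theorem additionMap_mem (X Y : ProjectiveVariety k N) (n : ℕ)
    (a : (embeddedJoin X Y).coordRing) (ha : a ∈ (embeddedJoin X Y).piece n) :
    additionMap X Y a ∈ ruledJoinPiece X Y n := by
  obtain ⟨f, hf, rfl⟩ := ha
  change substDiff X Y f ∈ _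
  have h1 : ∀ i, X.coord i ⊗ₜ[k] 1 - 1 ⊗ₜ[k] Y.coord i ∈ ruledJoinPiece X Y 1 := fun i =>
    sub_mem
      (Submodule.subset_span ⟨1, 0, rfl, _, ⟨_, MvPolynomial.isHomogeneous_X _ i, rfl⟩, 1,
        SetLike.GradedOne.one_mem, rfl⟩)
      (Submodule.subset_span ⟨0, 1, rfl, 1, SetLike.GradedOne.one_mem, _,
        ⟨_, MvPolynomial.isHomogeneous_X _ i, rfl⟩, rfl⟩)
  rw [substDiff, MvPolynomial.aeval_def, MvPolynomial.eval₂_eq]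
  refine sum_mem fun d hd => ?_
  rw [← Algebra.smul_def]
  refine Submodule.smul_mem _ _ ?_
  have hdn : ∑ i ∈ d.support, d i • 1 = n := by
    have := hf (MvPolynomial.mem_support_iff.1 hd)
    simpa [Finsupp.weight_apply, Finsupp.sum] using this
  rw [← hdn]
  exact SetLike.prod_pow_mem_graded (ruledJoinPiece X Y) _ _ _ fun i _ => h1 i

/-- `deg (J / XY)`: the degree of the dominant rational map `J(X, Y) ⇢ XY`,
`[x : y] ↦ [x - y]`, from the ruled join to the embedded join. -/
def joinDegree (X Y : ProjectiveVariety k N) : ℕ :=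
  GradedDomain.rationalMapDegree (embeddedJoin X Y).piece (ruledJoinPiece X Y) (additionMap X Y)
    (additionMap_injective X Y) (additionMap_mem X Y)

end Joins

end ProjectiveVariety

end

/-!
Let `C` be the affine cone over `X`. The cone over `σ_r` is the closure of the set of sums of `r`
points of `C`, so `XY = σ_(r+1)` for `Y = σ_r`. Moreover the maps `c ↦ (c_0, -(c_1 + ⋯ + c_r))` and
`c ↦ c_0 + ⋯ + c_r` from `C^(r+1)` to the cones over `J(X, σ_r)` and `σ_(r+1)` are dominant, and the
second one is the first one followed by the map `(x, y) ↦ x - y` on cones.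

Very ampleness makes any `2r + 2` points of `X` linearly independent. Hence two points of `C^(r+1)`
whose factors lie on distinct lines have the same sum only if they differ by a permutation: the
general fibres of the second map are orbits of the symmetric group on the `r + 1` factors, and those
of the first map are orbits of the stabilizer of the factor `0`. In characteristic zero a regular
function that is constant on general fibres comes from the function field of the target, so the
function field of `C^(r+1)` is Galois over those of the two targets, with these groups of orders
`(r + 1)!` and `r!`. The quotient `r + 1` is the degree between the targets.

The degree of a rational map of projective varieties can be computed on the affine cones, because
the fraction field of a graded domain with a nonzero element `h` of degree one is the field of
rational functions in `h` over the function field.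
-/

noncomputable section

/-! ## Galois covers with prescribed general fibres -/

theorem exists_algHom_apply_ne_zero {k R : Type*} [Field k] [IsAlgClosed k] [CommRing R]
    [Algebra k R] [Algebra.FiniteType k R] {u : R} (hu : ¬IsNilpotent u) :
    ∃ χ : R →ₐ[k] k, χ u ≠ 0 := by
  have hR : IsJacobsonRing R := isJacobsonRing_of_finiteType (A := k)
  obtain ⟨m, hm, hum⟩ : ∃ m : Ideal R, m.IsMaximal ∧ u ∉ m := by
    rw [← mem_nilradical, ← hR.out (I := nilradical R) (Ideal.radical_isRadical 0),
      Ideal.jacobson, Submodule.mem_sInf] at hu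
    push Not at hu
    obtain ⟨m, ⟨-, hm⟩, hum⟩ := hu
    exact ⟨m, hm, hum⟩
  let := Ideal.Quotient.field m
  have : Module.Finite k (R ⧸ m) := finite_of_finite_type_of_isJacobsonRing k (R ⧸ m)
  let e : k ≃ₐ[k] R ⧸ m := AlgEquiv.ofBijective (Algebra.ofId k _)
    IsAlgClosed.algebraMap_bijective_of_isIntegral
  refine ⟨e.symm.toAlgHom.comp (Ideal.Quotient.mkₐ k m), fun h => hum ?_⟩
  simpa [Ideal.Quotient.eq_zero_iff_mem] using h

section Descent

variable {E F : Type*} [Field E] [Field F] [Algebra E F]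

theorem mem_range_algebraMap_of_isNilpotent_of_isReduced {M : Type*} [CommRing M] [Algebra E M]
    [IsReduced (M ⊗[E] M)] {f : M →ₐ[E] F} (hf : Function.Injective f) {m : M}
    (h : IsNilpotent (f m ⊗ₜ[E] (1 : F) - 1 ⊗ₜ[E] f m)) : f m ∈ Set.range (algebraMap E F) := by
  have hinj : Function.Injective (Algebra.TensorProduct.map f f) :=
    TensorProduct.map_injective_of_flat_flat _ _ hf hf
  have hmap : Algebra.TensorProduct.map f f (m ⊗ₜ[E] 1 - 1 ⊗ₜ[E] m) =
      f m ⊗ₜ[E] (1 : F) - 1 ⊗ₜ[E] f m := by simp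
  rw [← hmap, IsNilpotent.map_iff hinj, isNilpotent_iff_eq_zero] at h
  refine (Algebra.IsEffective.of_faithfullyFlat E F (f m)).1 ?_
  rw [Algebra.TensorProduct.includeLeftSubRight_apply, ← hmap, h, map_zero]

open scoped IntermediateField in
theorem mem_range_algebraMap_of_isNilpotent [PerfectField E] {b : F}
    (h : IsNilpotent (b ⊗ₜ[E] (1 : F) - 1 ⊗ₜ[E] b)) : b ∈ Set.range (algebraMap E F) := by
  by_cases hb : IsAlgebraic E b
  · have : FiniteDimensional E E⟮b⟯ := IntermediateField.adjoin.finiteDimensional hb.isIntegral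
    have := Algebra.FormallyUnramified.of_isSeparable E E⟮b⟯
    have : IsReduced (E⟮b⟯ ⊗[E] E⟮b⟯) :=
      Algebra.FormallyUnramified.isReduced_of_field E⟮b⟯ (E⟮b⟯ ⊗[E] E⟮b⟯)
    exact mem_range_algebraMap_of_isNilpotent_of_isReduced (f := E⟮b⟯.val) Subtype.val_injective
      (m := IntermediateField.AdjoinSimple.gen E b) h
  · have : IsReduced (Polynomial E ⊗[E] Polynomial E) :=
      isReduced_of_injective _ (polyEquivTensor E (Polynomial E)).symm.injective
    have hX : Polynomial.aeval b (Polynomial.X : Polynomial E) = b := Polynomial.aeval_X b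
    rw [← hX] at h ⊢
    exact mem_range_algebraMap_of_isNilpotent_of_isReduced
      (transcendental_iff_injective.1 hb) h

theorem isNilpotent_tmul_mul_sub_of_forall_eq_on_fibres {k A B : Type*} [Field k] [IsAlgClosed k]
    [CommRing A] [Algebra k A] [CommRing B] [Algebra k B] [Algebra.FiniteType k B] [Algebra A B]
    [IsScalarTower k A B] {g b : B}
    (h : ∀ χ ψ : B →ₐ[k] k, (∀ a, χ (algebraMap A B a) = ψ (algebraMap A B a)) →
      χ g ≠ 0 → ψ g ≠ 0 → χ b = ψ b) :
    IsNilpotent (g ⊗ₜ[A] g * (b ⊗ₜ[A] 1 - 1 ⊗ₜ[A] b)) := by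
  have : Algebra.FiniteType A B := .of_restrictScalars_finiteType k A B
  have : Algebra.FiniteType k (B ⊗[A] B) := .trans (S := B) inferInstance inferInstance
  by_contra hu
  obtain ⟨χ, hχ⟩ := exists_algHom_apply_ne_zero (k := k) hu
  let χ₁ : B →ₐ[k] k := χ.comp Algebra.TensorProduct.includeLeft
  let χ₂ : B →ₐ[k] k :=
    χ.comp ((Algebra.TensorProduct.includeRight : B →ₐ[A] B ⊗[A] B).restrictScalars k)
  have hχu : χ (g ⊗ₜ[A] g * (b ⊗ₜ[A] 1 - 1 ⊗ₜ[A] b)) = χ₁ g * χ₂ g * (χ₁ b - χ₂ b) := by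
    simp [χ₁, χ₂, ← map_mul, ← map_sub]
  have hχ₁₂ (a : A) : χ₁ (algebraMap A B a) = χ₂ (algebraMap A B a) := by
    simp [χ₁, χ₂, Algebra.TensorProduct.tmul_one_eq_one_tmul]
  rw [hχu, mul_ne_zero_iff, mul_ne_zero_iff, sub_ne_zero] at hχ
  exact hχ.2 (h χ₁ χ₂ hχ₁₂ hχ.1.1 hχ.1.2)

theorem mem_range_algebraMap_of_forall_eq_on_fibres {k A B : Type*} [Field k] [IsAlgClosed k]
    [CommRing A] [Algebra k A] [CommRing B] [Algebra k B] [Algebra.FiniteType k B] [Algebra A B]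
    [IsScalarTower k A B] [PerfectField E] [Algebra A E] [Algebra A F] [Algebra B F]
    [IsScalarTower A E F] [IsScalarTower A B F] {g : B} (hg : algebraMap B F g ≠ 0) {b : B}
    (h : ∀ χ ψ : B →ₐ[k] k, (∀ a, χ (algebraMap A B a) = ψ (algebraMap A B a)) →
      χ g ≠ 0 → ψ g ≠ 0 → χ b = ψ b) :
    algebraMap B F b ∈ Set.range (algebraMap E F) := by
  let Φ : B ⊗[A] B →ₐ[A] F ⊗[E] F := Algebra.TensorProduct.lift
    ((Algebra.TensorProduct.includeLeft (R := E) (S := A) (A := F) (B := F)).comp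
      (IsScalarTower.toAlgHom A B F))
    (((Algebra.TensorProduct.includeRight (R := E) (A := F) (B := F)).restrictScalars A).comp
      (IsScalarTower.toAlgHom A B F))
    fun _ _ => Commute.all _ _
  have hunit : IsUnit (algebraMap B F g ⊗ₜ[E] algebraMap B F g) := by
    refine .of_mul_eq_one ((algebraMap B F g)⁻¹ ⊗ₜ[E] (algebraMap B F g)⁻¹) ?_
    simp [hg, Algebra.TensorProduct.one_def]
  refine mem_range_algebraMap_of_isNilpotent
    ((hunit.isNilpotent_unit_mul_of_commute_iff (.all _ _)).1 ?_)
  simpa [Φ] using (isNilpotent_tmul_mul_sub_of_forall_eq_on_fibres h).map Φ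

end Descent

section GaloisCover

variable {k A B E F G : Type*} [Field k] [IsAlgClosed k] [CommRing A] [Algebra k A] [CommRing B]
  [Algebra k B] [Algebra.FiniteType k B] [Algebra A B] [IsScalarTower k A B] [Field E]
  [PerfectField E] [Field F] [Algebra E F] [Algebra A E] [IsFractionRing A E]
  [Algebra A F] [Algebra B F] [IsFractionRing B F] [IsScalarTower A E F] [IsScalarTower A B F]
  [Group G] [Finite G] [MulSemiringAction G B] [FaithfulSMul G B] [SMulCommClass G A B]
  [MulSemiringAction G F] [SMulDistribClass G B F]

theorem isGaloisGroup_of_fibres_subset_orbits {g : B} (hg : g ≠ 0)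
    (h : ∀ χ ψ : B →ₐ[k] k, (∀ a, χ (algebraMap A B a) = ψ (algebraMap A B a)) →
      χ g ≠ 0 → ψ g ≠ 0 → ∃ σ : G, ∀ b, ψ b = χ (σ • b)) :
    IsGaloisGroup G E F where
  faithful := IsFractionRing.faithfulSMul G B F
  commutes := IsFractionRing.smulCommClass G A B E F
  isInvariant := by
    refine ⟨fun z hz => ?_⟩
    have : IsDomain B := (IsFractionRing.injective B F).isDomain
    let B₀ := FixedPoints.subring B G
    have hgF : algebraMap B F g ≠ 0 := by simpa using hg
    have hB₀ (b : B₀) : algebraMap B F b ∈ (algebraMap E F).fieldRange := by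
      refine mem_range_algebraMap_of_forall_eq_on_fibres (k := k) (A := A) hgF
        fun χ ψ hA hχ hψ => ?_
      obtain ⟨σ, hσ⟩ := h χ ψ hA hχ hψ
      rw [hσ, b.2 σ]
    have : Algebra.IsInvariant B₀ B G := ⟨fun b hb => ⟨⟨b, hb⟩, rfl⟩⟩
    let := FractionRing.liftAlgebra B₀ F
    have : Algebra.IsInvariant (FractionRing B₀) F G :=
      IsFractionRing.isInvariant G B₀ B (FractionRing B₀) F
    obtain ⟨y, rfl⟩ := this.isInvariant z hz
    obtain ⟨a, b, -, rfl⟩ := IsFractionRing.div_surjective B₀ y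
    rw [map_div₀, ← IsScalarTower.algebraMap_apply, ← IsScalarTower.algebraMap_apply]
    exact div_mem (hB₀ a) (hB₀ b)

end GaloisCover

attribute [local instance] FractionRing.liftAlgebra in
theorem finrank_fractionRing_eq_card_of_fibres_subset_orbits {k A B : Type*} (G : Type*) [Field k]
    [IsAlgClosed k] [CharZero k] [CommRing A] [IsDomain A] [Algebra k A] [CommRing B] [IsDomain B]
    [Algebra k B] [Algebra.FiniteType k B] [Algebra A B] [FaithfulSMul A B] [IsScalarTower k A B]
    [Group G] [Finite G] [MulSemiringAction G B] [FaithfulSMul G B] [SMulCommClass G A B] {g : B}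
    (hg : g ≠ 0)
    (h : ∀ χ ψ : B →ₐ[k] k, (∀ a, χ (algebraMap A B a) = ψ (algebraMap A B a)) →
      χ g ≠ 0 → ψ g ≠ 0 → ∃ σ : G, ∀ b, ψ b = χ (σ • b)) :
    Module.finrank (FractionRing A) (FractionRing B) = Nat.card G := by
  have : CharZero (FractionRing A) :=
    charZero_of_injective_algebraMap (algebraMap k (FractionRing A)).injective
  let := IsFractionRing.mulSemiringAction G B (FractionRing B)
  have : IsGaloisGroup G (FractionRing A) (FractionRing B) :=
    isGaloisGroup_of_fibres_subset_orbits (k := k) (A := A) hg h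
  exact (IsGaloisGroup.card_eq_finrank G _ _).symm

attribute [local instance] FractionRing.liftAlgebra in
theorem finrank_fractionRing_mul_finrank_fractionRing (A R B : Type*) [CommRing A] [IsDomain A]
    [CommRing R] [IsDomain R] [CommRing B] [IsDomain B] [Algebra A R] [Algebra R B] [Algebra A B]
    [IsScalarTower A R B] [FaithfulSMul A R] [FaithfulSMul R B] [FaithfulSMul A B] :
    Module.finrank (FractionRing A) (FractionRing R) *
      Module.finrank (FractionRing R) (FractionRing B) =
        Module.finrank (FractionRing A) (FractionRing B) :=
  Module.finrank_mul_finrank _ _ _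

/-! ## Degrees of rational maps on affine cones -/

namespace GradedDomain

theorem iSupIndep_of_algebraMap_mem {k R R' : Type*} [Field k] [CommRing R] [Algebra k R]
    [CommRing R'] [Algebra k R'] [Algebra R R'] [FaithfulSMul R R'] {𝒜 : ℕ → Submodule k R}
    {ℬ : ℕ → Submodule k R'} (hgr : ∀ n, ∀ a ∈ 𝒜 n, algebraMap R R' a ∈ ℬ n)
    (hℬ : iSupIndep ℬ) : iSupIndep 𝒜 := by
  rw [iSupIndep_iff_finsetSum_eq_zero_imp_eq_zero] at hℬ ⊢
  intro s a ha hsum n hn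
  refine FaithfulSMul.algebraMap_injective R R' ?_
  rw [map_zero]
  exact hℬ s _ (fun n hn => hgr n _ (ha n hn)) (by rw [← map_sum, hsum, map_zero]) n hn

section

variable {k R : Type*} [Field k] [CommRing R] [IsDomain R] [Algebra k R]
  (𝒜 : ℕ → Submodule k R) [SetLike.GradedMonoid 𝒜]

theorem exists_common_denominator {ι : Type*} (s : Finset ι) (b : ι → functionField 𝒜) :
    ∃ m, ∃ d ≠ 0, ∃ a : ι → R, (∀ i ∈ s, a i ∈ 𝒜 m) ∧
      ∀ i ∈ s, (b i : FractionRing R) * algebraMap R _ d = algebraMap R _ (a i) := by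
  classical
  choose n a ha d hd hd0 hb using fun i => (b i).2
  refine ⟨∑ i ∈ s, n i, ∏ i ∈ s, d i, Finset.prod_ne_zero_iff.2 fun i _ => hd0 i,
    fun i => a i * ∏ j ∈ s.erase i, d j, fun i hi => ?_, fun i hi => ?_⟩
  · rw [← Finset.add_sum_erase _ _ hi]
    exact SetLike.GradedMul.mul_mem (ha i) (SetLike.prod_mem_graded 𝒜 _ _ fun j _ => hd j)
  · have : algebraMap R (FractionRing R) (d i) ≠ 0 := by simpa using hd0 i
    rw [← Finset.mul_prod_erase _ _ hi, map_mul, map_mul, hb i]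
    field_simp

variable {𝒜} {h : R}

theorem transcendental_of_mem_one (h𝒜 : iSupIndep 𝒜) (hh : h ∈ 𝒜 1) (h0 : h ≠ 0) :
    Transcendental (functionField 𝒜) (algebraMap R (FractionRing R) h) := by
  rw [transcendental_iff]
  intro p hp
  obtain ⟨m, d, hd, a, ha, hpa⟩ := exists_common_denominator 𝒜 p.support p.coeff
  have hsum : ∑ n ∈ p.support, a n * h ^ n = 0 := by
    apply IsFractionRing.injective R (FractionRing R)
    rw [map_zero, ← zero_mul (algebraMap R (FractionRing R) d), ← hp, Polynomial.aeval_def,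
      Polynomial.eval₂_eq_sum, Polynomial.sum, map_sum, Finset.sum_mul]
    refine Finset.sum_congr rfl fun n hn => ?_
    rw [map_mul, map_pow, ← hpa n hn, mul_right_comm]
    rfl
  have hterm (n) (hn : n ∈ p.support) : a n * h ^ n = 0 :=
    (iSupIndep_iff_finsetSum_eq_zero_imp_eq_zero _).1 (h𝒜.comp (add_right_injective m)) p.support
      _ (fun n hn => SetLike.GradedMul.mul_mem (ha n hn)
        (by simpa using SetLike.pow_mem_graded n hh)) hsum n hn
  refine Polynomial.support_eq_empty.1 (Finset.eq_empty_of_forall_notMem fun n hn => ?_)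
  have han : a n = 0 := (mul_eq_zero.1 (hterm n hn)).resolve_right (pow_ne_zero n h0)
  exact Polynomial.mem_support_iff.1 hn (by simpa [han, hd] using hpa n hn)

theorem exists_aeval_eq_algebraMap (h𝒜 : ⨆ n, 𝒜 n = ⊤) (hh : h ∈ 𝒜 1) (h0 : h ≠ 0) (a : R) :
    ∃ p : Polynomial (functionField 𝒜),
      Polynomial.aeval (algebraMap R (FractionRing R) h) p = algebraMap R _ a := by
  induction (h𝒜 ▸ Submodule.mem_top : a ∈ ⨆ n, 𝒜 n) using Submodule.iSup_induction' with
  | mem n a ha =>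
    refine ⟨.monomial n ⟨algebraMap R _ a / algebraMap R _ (h ^ n), n, a, ha, h ^ n,
      by simpa using SetLike.pow_mem_graded n hh, pow_ne_zero n h0, rfl⟩, ?_⟩
    rw [Polynomial.aeval_monomial, ← map_pow]
    have hhn : algebraMap R (FractionRing R) (h ^ n) ≠ 0 := by simpa using pow_ne_zero n h0
    exact div_mul_cancel₀ (algebraMap R (FractionRing R) a) hhn
  | zero => exact ⟨0, by simp⟩
  | add a b _ _ ha hb =>
    obtain ⟨p, hp⟩ := ha
    obtain ⟨q, hq⟩ := hb
    exact ⟨p + q, by simp [hp, hq]⟩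

theorem isFractionRing_aeval (h𝒜 : ⨆ n, 𝒜 n = ⊤) (hind : iSupIndep 𝒜) (hh : h ∈ 𝒜 1)
    (h0 : h ≠ 0) :
    letI := (Polynomial.aeval (R := functionField 𝒜)
      (algebraMap R (FractionRing R) h)).toRingHom.toAlgebra
    IsFractionRing (Polynomial (functionField 𝒜)) (FractionRing R) := by
  let := (Polynomial.aeval (R := functionField 𝒜)
    (algebraMap R (FractionRing R) h)).toRingHom.toAlgebra
  have : FaithfulSMul (Polynomial (functionField 𝒜)) (FractionRing R) :=
    (faithfulSMul_iff_algebraMap_injective _ _).2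
      (transcendental_iff_injective.1 (transcendental_of_mem_one hind hh h0))
  refine IsFractionRing.of_field _ _ fun z => ?_
  obtain ⟨a, b, -, rfl⟩ := IsFractionRing.div_surjective R z
  obtain ⟨p, hp⟩ := exists_aeval_eq_algebraMap h𝒜 hh h0 a
  obtain ⟨q, hq⟩ := exists_aeval_eq_algebraMap h𝒜 hh h0 b
  exact ⟨p, q, by rw [← hp, ← hq]; rfl⟩

end

variable {k R R' : Type*} [Field k] [CommRing R] [IsDomain R] [Algebra k R] [CommRing R']
  [IsDomain R'] [Algebra k R'] [Algebra R R'] [IsScalarTower k R R'] [FaithfulSMul R R']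
  {𝒜 : ℕ → Submodule k R} [SetLike.GradedMonoid 𝒜] {ℬ : ℕ → Submodule k R'}
  [SetLike.GradedMonoid ℬ]

attribute [local instance] FractionRing.liftAlgebra Polynomial.algebra in
theorem rationalMapDegree_eq_finrank (hgr : ∀ n, ∀ a ∈ 𝒜 n, algebraMap R R' a ∈ ℬ n)
    (h𝒜 : ⨆ n, 𝒜 n = ⊤) (hℬ : ⨆ n, ℬ n = ⊤) (hind : iSupIndep ℬ) {h : R} (hh : h ∈ 𝒜 1)
    (h0 : h ≠ 0) :
    rationalMapDegree 𝒜 ℬ (IsScalarTower.toAlgHom k R R')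
      (FaithfulSMul.algebraMap_injective R R') hgr =
        Module.finrank (FractionRing R) (FractionRing R') := by
  have hinj := FaithfulSMul.algebraMap_injective R R'
  let := (pullback 𝒜 ℬ (IsScalarTower.toAlgHom k R R') hinj hgr).toAlgebra
  let := (Polynomial.aeval (R := functionField 𝒜)
    (algebraMap R (FractionRing R) h)).toRingHom.toAlgebra
  let := (Polynomial.aeval (R := functionField ℬ)
    (algebraMap R' (FractionRing R') (algebraMap R R' h))).toRingHom.toAlgebra
  let : Algebra (Polynomial (functionField 𝒜)) (FractionRing R') :=
    ((algebraMap (FractionRing R) (FractionRing R')).comp (algebraMap _ _)).toAlgebra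
  have : IsScalarTower (Polynomial (functionField 𝒜)) (FractionRing R) (FractionRing R') :=
    .of_algebraMap_eq fun _ => rfl
  have : IsScalarTower (Polynomial (functionField 𝒜)) (Polynomial (functionField ℬ))
      (FractionRing R') := by
    refine .of_algebraMap_eq fun p => ?_
    refine (Polynomial.map_aeval_eq_aeval_map (φ := algebraMap (functionField 𝒜) (functionField ℬ))
      (ψ := algebraMap (FractionRing R) (FractionRing R')) rfl p _).trans ?_
    rw [← IsScalarTower.algebraMap_apply, IsScalarTower.algebraMap_apply R R' (FractionRing R')]
    rfl
  have := isFractionRing_aeval h𝒜 (iSupIndep_of_algebraMap_mem hgr hind) hh h0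
  have := isFractionRing_aeval hℬ hind (hgr 1 h hh) (by simpa using h0)
  rw [IsFractionRing.finrank_eq (Polynomial (functionField 𝒜)) (FractionRing R)
    (Polynomial (functionField ℬ)) (FractionRing R')]
  exact congrArg Cardinal.toNat
    (rank_polynomial_polynomial (functionField 𝒜) (functionField ℬ)).symm

end GradedDomain

/-! ## Linear independence of points -/

theorem exists_perm_of_sum_eq_of_iSupIndep {R M ι κ : Type*} [Ring R] [AddCommGroup M] [Module R M]
    [Fintype ι] {W : κ → Submodule R M} (hW : iSupIndep W) {P Q : ι → κ}
    (hP : Function.Injective P) (hQ : Function.Injective Q) {a b : ι → M}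
    (ha : ∀ i, a i ∈ W (P i)) (hb : ∀ i, b i ∈ W (Q i)) (hb0 : ∀ i, b i ≠ 0)
    (hab : ∑ i, a i = ∑ i, b i) : ∃ σ : Equiv.Perm ι, ∀ i, b i = a (σ i) := by
  classical
  let part (P : ι → κ) (a : ι → M) (s : κ) : M := ∑ i, if P i = s then a i else 0
  have part_mem {P a} (ha : ∀ i, a i ∈ W (P i)) (s : κ) : part P a s ∈ W s :=
    sum_mem fun i _ => by split_ifs with h; exacts [h ▸ ha i, zero_mem _]
  have sum_part {P : ι → κ} (a) {S : Finset κ} (hS : ∀ i, P i ∈ S) :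
      ∑ s ∈ S, part P a s = ∑ i, a i := by
    rw [Finset.sum_comm]
    simp [hS]
  have part_apply {P a} (hP : Function.Injective P) (i : ι) : part P a (P i) = a i := by
    simp [part, hP.eq_iff]
  let S := Finset.univ.image P ∪ Finset.univ.image Q
  have hPS (i) : P i ∈ S := Finset.mem_union_left _ (Finset.mem_image_of_mem P (Finset.mem_univ i))
  have hQS (i) : Q i ∈ S := Finset.mem_union_right _ (Finset.mem_image_of_mem Q (Finset.mem_univ i))
  have hparts (s) (hs : s ∈ S) : part P a s = part Q b s :=
    (iSupIndep_iff_finsetSum_eq_imp_eq W).1 hW S _ _ (fun s _ => ⟨part_mem ha s, part_mem hb s⟩)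
      (by rw [sum_part a hPS, sum_part b hQS, hab]) s hs
  have hrange : ∀ i, ∃ j, P j = Q i := fun i => by
    by_contra! hi
    refine hb0 i ?_
    rw [← part_apply (a := b) hQ i, ← hparts _ (hQS i)]
    exact Finset.sum_eq_zero fun j _ => if_neg (hi j)
  choose σ hσ using hrange
  have hσ_inj : Function.Injective σ := fun i j hij => hQ (by rw [← hσ, ← hσ, hij])
  refine ⟨Equiv.ofBijective σ (Finite.injective_iff_bijective.1 hσ_inj), fun i => ?_⟩
  rw [← part_apply (a := b) hQ i, ← hparts _ (hQS i), ← hσ, part_apply hP]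
  rfl

namespace ProjectiveVariety

variable {k : Type*} [Field k] {N : ℕ} (X : ProjectiveVariety k N)

theorem piece_one_eq_span_coord : X.piece 1 = Submodule.span k (Set.range X.coord) := by
  rw [piece, MvPolynomial.homogeneousSubmodule_one_eq_span_X, Submodule.map_span,
    ← Set.range_comp]
  rfl

theorem coord_mem_piece (i : Fin (N + 1)) : X.coord i ∈ X.piece 1 :=
  ⟨_, MvPolynomial.isHomogeneous_X k i, rfl⟩

theorem exists_dual_eq_evalAt {l : X.coordRing} (hl : l ∈ X.piece 1) :
    ∃ φ : Module.Dual k (Fin (N + 1) → k), ∀ v : X.cone, φ v = X.evalAt v l := by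
  rw [piece_one_eq_span_coord, Submodule.mem_span_range_iff_exists_fun] at hl
  obtain ⟨c, rfl⟩ := hl
  refine ⟨∑ i, c i • LinearMap.proj i, fun v => ?_⟩
  simp [coord]

theorem exists_mem_piece_one_evalAt_eq (φ : Module.Dual k (Fin (N + 1) → k)) :
    ∃ l ∈ X.piece 1, ∀ v : X.cone, X.evalAt v l = φ v := by
  classical
  refine ⟨∑ i, φ (fun j => if i = j then 1 else 0) • X.coord i,
    sum_mem fun i _ => Submodule.smul_mem _ _ (X.coord_mem_piece i), fun v => ?_⟩
  rw [LinearMap.pi_apply_eq_sum_univ φ]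
  simp [coord, mul_comm]

variable {X}

/-- The local ring of the affine cone over `X` at the point `v`, as a subring of the fraction field
of the homogeneous coordinate ring. -/
def localRing (v : X.cone) : Subalgebra X.coordRing (FractionRing X.coordRing) :=
  Localization.subalgebra.ofField _ ((nonZeroDivisors k).comap (X.evalAt v)) fun f hf =>
    mem_nonZeroDivisors_of_ne_zero (by rintro rfl; simp at hf)

instance (v : X.cone) :
    IsLocalization ((nonZeroDivisors k).comap (X.evalAt v)) (localRing v) :=
  Localization.subalgebra.isLocalization_ofField _ _ _

/-- Evaluation of the functions regular at `v`. -/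
def evalLocal (v : X.cone) : localRing v →ₐ[k] k :=
  IsLocalization.liftAlgHom (M := (nonZeroDivisors k).comap (X.evalAt v)) (f := X.evalAt v)
    fun f => isUnit_iff_ne_zero.2 (nonZeroDivisors.ne_zero f.2)

theorem evalLocal_algebraMap (v : X.cone) (f : X.coordRing) :
    evalLocal v (algebraMap X.coordRing (localRing v) f) = X.evalAt v f :=
  IsLocalization.lift_eq _ f

variable {h : X.piece 1} (v : X.cone)

theorem chartRing_le_localRing (hv : X.evalAt v h ≠ 0) :
    X.chartRing h ≤ (localRing v).restrictScalars k := by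
  rintro z ⟨m, f, -, hz⟩
  have hh : algebraMap X.coordRing (FractionRing X.coordRing) h ≠ 0 := by
    simpa using fun h0 : (h : X.coordRing) = 0 => hv (by rw [h0, map_zero])
  exact ⟨f, h ^ m, by simpa using fun h0 => absurd h0 hv,
    by rw [← hz, map_pow, mul_inv_cancel_right₀ (pow_ne_zero m hh)]⟩

/-- Evaluation of the regular functions on the affine open set `D(h) ⊆ X` at the point of `D(h)`
with homogeneous coordinates `v`. -/
def evalChart (hv : X.evalAt v h ≠ 0) : X.chartRing h →ₐ[k] k :=
  AlgHom.comp (B := (localRing v).restrictScalars k) (evalLocal v)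
    (Subalgebra.inclusion (chartRing_le_localRing v hv))

theorem evalChart_mul_evalAt (hv : X.evalAt v h ≠ 0) {z : X.chartRing h} {l : X.coordRing}
    (hz : (z : FractionRing X.coordRing) * algebraMap _ _ (h : X.coordRing) = algebraMap _ _ l) :
    evalChart v hv z * X.evalAt v h = X.evalAt v l := by
  let w : localRing v := ⟨z, chartRing_le_localRing v hv z.2⟩
  have hw : w * algebraMap _ _ (h : X.coordRing) = algebraMap _ _ l := Subtype.ext hz
  rw [← evalLocal_algebraMap, ← evalLocal_algebraMap, ← hw, map_mul]
  rfl

theorem exists_chartRing_mul_eq (h0 : h ≠ 0) {l : X.coordRing} (hl : l ∈ X.piece 1) :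
    ∃ z : X.chartRing h, (z : FractionRing X.coordRing) * algebraMap _ _ (h : X.coordRing) =
      algebraMap _ _ l := by
  have hh : algebraMap X.coordRing (FractionRing X.coordRing) h ≠ 0 := by simpa using h0
  have hz := div_mul_cancel₀ (algebraMap X.coordRing (FractionRing X.coordRing) l) hh
  exact ⟨⟨_, 1, l, hl, by rw [pow_one, hz]⟩, hz⟩

variable {v}

theorem evalAt_smul_eq_of_evalChart_eq {w : X.cone} (hv : X.evalAt v h ≠ 0)
    (hw : X.evalAt w h ≠ 0) (hvw : evalChart v hv = evalChart w hw) :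
    X.evalAt w h • (v : Fin (N + 1) → k) = X.evalAt v h • (w : Fin (N + 1) → k) := by
  ext j
  obtain ⟨z, hz⟩ := exists_chartRing_mul_eq (h := h)
    (fun h0 => hv (by rw [h0, ZeroMemClass.coe_zero, map_zero])) (X.coord_mem_piece j)
  have hvj := evalChart_mul_evalAt v hv hz
  have hwj := evalChart_mul_evalAt w hw hz
  simp only [coord, evalAt_toCoordRing, MvPolynomial.aeval_X] at hvj hwj
  rw [Pi.smul_apply, Pi.smul_apply, ← hvj, ← hwj, hvw, smul_eq_mul, smul_eq_mul]
  ring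

theorem IsVeryAmple.exists_dual_eq_evalChart {d : ℕ} (hva : X.IsVeryAmple d)
    (hemb : X.IsCompletelyEmbedded) {ι : Type*} [Fintype ι] (hι : Fintype.card ι ≤ d + 1)
    {v : ι → X.cone} (hv : ∀ i, X.evalAt (v i) h ≠ 0) (z : X.chartRing h) :
    ∃ φ : Module.Dual k (Fin (N + 1) → k), ∀ i, φ (v i) =
      evalChart (v i) (hv i) z * X.evalAt (v i) h := by
  by_cases h0 : h = 0
  · exact ⟨0, fun i => absurd (by rw [h0, ZeroMemClass.coe_zero, map_zero]) (hv i)⟩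
  let evalAll : X.chartRing h →ₐ[k] ι → k := AlgHom.pi fun i => evalChart (v i) (hv i)
  have hinj : Function.Injective (Ideal.kerLiftAlg evalAll).toLinearMap :=
    Ideal.kerLiftAlg_injective evalAll
  have hlength : Module.finrank k (X.chartRing h ⧸ RingHom.ker evalAll) ≤ d + 1 :=
    (LinearMap.finrank_le_finrank_of_injective hinj).trans (by simpa using hι)
  obtain ⟨s, hs⟩ := hva h h0 _ (Module.Finite.of_injective _ hinj) hlength (Ideal.Quotient.mk _ z)
  obtain ⟨l, hl, hsl⟩ := hemb s s.2
  obtain ⟨φ, hφ⟩ := X.exists_dual_eq_evalAt hl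
  refine ⟨φ, fun i => ?_⟩
  let w : X.chartRing h := ⟨_, s.2 h h0⟩
  have hw : (w : FractionRing X.coordRing) * algebraMap _ _ (h : X.coordRing) =
      algebraMap _ _ l := by
    rw [← hsl]
    exact div_mul_cancel₀ _ (by simpa using h0)
  have hwz : w - z ∈ RingHom.ker evalAll := (Ideal.Quotient.mk_eq_mk_iff_sub_mem _ _).1 hs
  rw [RingHom.mem_ker, map_sub, sub_eq_zero] at hwz
  rw [hφ, ← evalChart_mul_evalAt _ (hv i) hw]
  exact congrArg (· * X.evalAt (v i) h) (congrFun hwz i)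

theorem IsVeryAmple.independent [Infinite k] {d : ℕ} (hva : X.IsVeryAmple d)
    (hemb : X.IsCompletelyEmbedded) {ι : Type*} [Fintype ι] (hι : Fintype.card ι ≤ d + 1)
    {p : ι → ℙ k (Fin (N + 1) → k)} (hp : ∀ i, p i ∈ X.points) (hinj : Function.Injective p) :
    Projectivization.Independent p := by
  let v : ι → X.cone := fun i => ⟨(p i).rep, hp i⟩
  obtain ⟨η, hη⟩ := Module.exists_dual_forall_apply_ne_zero (K := k) (fun i => (p i).rep)
    fun i => (p i).rep_nonzero
  obtain ⟨l, hl, hlη⟩ := X.exists_mem_piece_one_evalAt_eq η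
  let h : X.piece 1 := ⟨l, hl⟩
  have hv : ∀ i, X.evalAt (v i) h ≠ 0 := fun i => by simpa only [h, hlη] using hη i
  have hχ : Function.Injective fun i => (evalChart (v i) (hv i) : X.chartRing h →* k) := by
    intro i j hij
    have hij' := evalAt_smul_eq_of_evalChart_eq (hv i) (hv j)
      (AlgHom.ext fun z => DFunLike.congr_fun hij z)
    rw [← eq_inv_smul_iff₀ (hv j), smul_smul] at hij'
    apply hinj
    rw [← (p i).mk_rep, ← (p j).mk_rep]
    exact (Projectivization.mk_eq_mk_iff' ..).2 ⟨_, hij'.symm⟩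
  have hdedekind := (linearIndependent_monoidHom (X.chartRing h) k).comp _ hχ
  rw [Projectivization.independent_iff, Fintype.linearIndependent_iff]
  intro g hg i
  have hsum : ∑ i, (g i * X.evalAt (v i) h) • ⇑(evalChart (v i) (hv i)) = 0 := by
    ext z
    obtain ⟨φ, hφ⟩ := hva.exists_dual_eq_evalChart hemb hι hv z
    have hφg := congrArg φ hg
    rw [map_sum, map_zero] at hφg
    rw [Finset.sum_apply, Pi.zero_apply, ← hφg]
    refine Finset.sum_congr rfl fun i _ => ?_
    rw [map_smul, Pi.smul_apply, smul_eq_mul, smul_eq_mul, mul_assoc, mul_comm (X.evalAt _ _)]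
    exact congrArg (g i * ·) (hφ i).symm
  exact (mul_eq_zero.1 (Fintype.linearIndependent_iff.1 hdedekind _ hsum i)).resolve_right (hv i)

theorem IsVeryAmple.exists_perm_of_sum_eq [Infinite k] {d : ℕ} (hva : X.IsVeryAmple d)
    (hemb : X.IsCompletelyEmbedded) {ι : Type*} [Fintype ι]
    (hι : Fintype.card ι + Fintype.card ι ≤ d + 1) {a b : ι → Fin (N + 1) → k}
    (ha : ∀ i, a i ∈ X.cone) (hb : ∀ i, b i ∈ X.cone) (ha0 : ∀ i, a i ≠ 0) (hb0 : ∀ i, b i ≠ 0)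
    (hainj : Function.Injective fun i => Projectivization.mk k (a i) (ha0 i))
    (hbinj : Function.Injective fun i => Projectivization.mk k (b i) (hb0 i))
    (hab : ∑ i, a i = ∑ i, b i) : ∃ σ : Equiv.Perm ι, ∀ i, b i = a (σ i) := by
  classical
  let p : ι → ℙ k (Fin (N + 1) → k) := fun i => Projectivization.mk k (a i) (ha0 i)
  let q : ι → ℙ k (Fin (N + 1) → k) := fun i => Projectivization.mk k (b i) (hb0 i)
  let S := Finset.univ.image p ∪ Finset.univ.image q
  have hpS : ∀ i, p i ∈ S := fun i =>
    Finset.mem_union_left _ (Finset.mem_image_of_mem p (Finset.mem_univ i))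
  have hqS : ∀ i, q i ∈ S := fun i =>
    Finset.mem_union_right _ (Finset.mem_image_of_mem q (Finset.mem_univ i))
  have hS : ∀ r : S, (r : ℙ k (Fin (N + 1) → k)) ∈ X.points := by
    rintro ⟨r, hr⟩
    rcases Finset.mem_union.1 hr with hr | hr <;> obtain ⟨i, -, rfl⟩ := Finset.mem_image.1 hr
    exacts [X.mk_mem_points (ha i) (ha0 i), X.mk_mem_points (hb i) (hb0 i)]
  have hcard : Fintype.card S ≤ d + 1 := by
    rw [Fintype.card_coe]
    exact ((Finset.card_union_le _ _).trans
      (add_le_add Finset.card_image_le Finset.card_image_le)).trans hι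
  have hind := hva.independent hemb hcard hS Subtype.val_injective
  refine exists_perm_of_sum_eq_of_iSupIndep (Projectivization.independent_iff_iSupIndep.1 hind)
    (P := fun i => ⟨p i, hpS i⟩) (Q := fun i => ⟨q i, hqS i⟩)
    (fun i j hij => hainj (congrArg Subtype.val hij))
    (fun i j hij => hbinj (congrArg Subtype.val hij)) (fun i => ?_) (fun i => ?_) hb0 hab
  exacts [Submodule.mem_span_singleton_self _, Submodule.mem_span_singleton_self _]

end ProjectiveVariety

/-! ## Graded pieces, joins and secant varieties -/

/-- Precomposition with `φ`, as a homomorphism of algebras of functions. -/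
def precompAlgHom (R : Type*) [CommSemiring R] {S T : Type*} (φ : S → T) :
    (T → R) →ₐ[R] (S → R) :=
  AlgHom.pi fun s => Pi.evalAlgHom R (fun _ => R) (φ s)

theorem mul_ne_zero_of_forall_update_mem {ι : Type*} [Finite ι] [DecidableEq ι] {V : ι → Type*}
    {R : Type*} [MulZeroClass R] [NoZeroDivisors R] {A : ∀ i, Set (V i → R)}
    (hA : ∀ i, ∀ p ∈ A i, ∀ q ∈ A i, p ≠ 0 → q ≠ 0 → p * q ≠ 0) {f g : (∀ i, V i) → R}
    (hfA : ∀ c i, (fun v => f (Function.update c i v)) ∈ A i)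
    (hgA : ∀ c i, (fun v => g (Function.update c i v)) ∈ A i) (hf : f ≠ 0) (hg : g ≠ 0) :
    f * g ≠ 0 := by
  have := Fintype.ofFinite ι
  -- Move a point where `f ≠ 0` and one where `g ≠ 0` together, one coordinate at a time.
  have agree_on : ∀ s : Finset ι, ∃ a b, f a ≠ 0 ∧ g b ≠ 0 ∧ ∀ i ∈ s, a i = b i := fun s => by
    induction s using Finset.induction_on with
    | empty =>
      obtain ⟨a, ha⟩ := Function.ne_iff.1 hf
      obtain ⟨b, hb⟩ := Function.ne_iff.1 hg
      exact ⟨a, b, ha, hb, by simp⟩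
    | insert i s _ ih =>
      obtain ⟨a, b, ha, hb, hab⟩ := ih
      obtain ⟨v, hv⟩ := Function.ne_iff.1 <| hA i _ (hfA a i) _ (hgA b i)
        (Function.ne_iff.2 ⟨a i, by simpa using ha⟩) (Function.ne_iff.2 ⟨b i, by simpa using hb⟩)
      refine ⟨Function.update a i v, Function.update b i v, left_ne_zero_of_mul hv,
        right_ne_zero_of_mul hv, fun j hj => ?_⟩
      rcases eq_or_ne j i with rfl | hji
      · simp
      · simpa [hji] using hab j (Finset.mem_of_mem_insert_of_ne hj hji)
  obtain ⟨a, b, ha, hb, hab⟩ := agree_on Finset.univ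
  obtain rfl : a = b := funext fun i => hab i (Finset.mem_univ i)
  exact Function.ne_iff.2 ⟨a, mul_ne_zero ha hb⟩

theorem mk_eq_mk_of_forall_mul_eq_mul {K ι : Type*} [Field K] {v w : ι → K} (hv : v ≠ 0)
    (hw : w ≠ 0) (h : ∀ i j, v i * w j = v j * w i) :
    Projectivization.mk K v hv = Projectivization.mk K w hw := by
  obtain ⟨j, hj : w j ≠ 0⟩ := Function.ne_iff.1 hw
  refine (Projectivization.mk_eq_mk_iff' _ _ _ _ _).2 ⟨v j / w j, funext fun i => ?_⟩
  rw [Pi.smul_apply, smul_eq_mul, div_mul_eq_mul_div, div_eq_iff hj, h]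

namespace ProjectiveVariety

variable {k : Type*} [Field k] {N : ℕ} (X Y : ProjectiveVariety k N)

@[simp]
theorem evalAt_coord (v : X.cone) (j : Fin (N + 1)) : X.evalAt v (X.coord j) = v.1 j := by
  simp [coord]

theorem adjoin_range_coord : Algebra.adjoin k (Set.range X.coord) = ⊤ := by
  have : Set.range X.coord = X.toCoordRing '' Set.range MvPolynomial.X := Set.range_comp _ _
  rw [this, ← AlgHom.map_adjoin, MvPolynomial.adjoin_range_X, Algebra.map_top,
    AlgHom.range_eq_top]
  exact X.toCoordRing_surjective

variable {X Y} in
theorem eq_of_ideal_eq (h : X.ideal = Y.ideal) : X = Y := by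
  cases X; cases Y; cases h; rfl

variable {X} in
theorem algHom_coord_mem_cone (χ : X.coordRing →ₐ[k] k) : (fun j => χ (X.coord j)) ∈ X.cone :=
  fun f hf => by
    have : MvPolynomial.aeval (fun j => χ (X.coord j)) = χ.comp X.toCoordRing :=
      MvPolynomial.algHom_ext fun j => by simp [coord]
    rw [this, AlgHom.comp_apply, (X.toCoordRing_eq_zero_iff f).2 hf, map_zero]

variable {X} in
theorem neg_mem_cone {v : Fin (N + 1) → k} (hv : v ∈ X.cone) : -v ∈ X.cone := by
  simpa using X.smul_mem_cone (-1) hv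

theorem iSup_piece : ⨆ n, X.piece n = ⊤ := by
  rw [eq_top_iff]
  intro a _
  obtain ⟨f, rfl⟩ := X.toCoordRing_surjective a
  rw [← MvPolynomial.sum_homogeneousComponent f, map_sum]
  exact Submodule.sum_mem _ fun n _ => Submodule.mem_iSup_of_mem n
    ⟨_, MvPolynomial.homogeneousComponent_isHomogeneous n f, rfl⟩

theorem evalAt_smul (c : k) (v : X.cone) {n : ℕ} {a : X.coordRing} (ha : a ∈ X.piece n) :
    X.evalAt ⟨c • v.1, X.smul_mem_cone c v.2⟩ a = c ^ n * X.evalAt v a := by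
  obtain ⟨f, hf, rfl⟩ := ha
  exact aeval_smul_of_isHomogeneous hf c v.1

@[simp]
theorem evalLeft_tmul (v : X.cone) (a : X.coordRing) (b : Y.coordRing) :
    evalLeft X Y v (a ⊗ₜ b) = X.evalAt v a • b := by
  simp [evalLeft, Algebra.ofId_apply, Algebra.smul_def]

theorem iSup_ruledJoinPiece : ⨆ n, ruledJoinPiece X Y n = ⊤ := by
  have tmul_mem (a : X.coordRing) (b : Y.coordRing) : a ⊗ₜ b ∈ ⨆ n, ruledJoinPiece X Y n := by
    have ha : a ∈ ⨆ n, X.piece n := X.iSup_piece ▸ Submodule.mem_top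
    have hb : b ∈ ⨆ n, Y.piece n := Y.iSup_piece ▸ Submodule.mem_top
    induction ha using Submodule.iSup_induction' with
    | zero => rw [TensorProduct.zero_tmul]; exact zero_mem _
    | add x y _ _ hx hy => rw [TensorProduct.add_tmul]; exact add_mem hx hy
    | mem i a ha =>
      induction hb using Submodule.iSup_induction' with
      | zero => rw [TensorProduct.tmul_zero]; exact zero_mem _
      | add x y _ _ hx hy => rw [TensorProduct.tmul_add]; exact add_mem hx hy
      | mem j b hb =>
        exact Submodule.mem_iSup_of_mem (i + j)
          (Submodule.subset_span ⟨i, j, rfl, a, ha, b, hb, rfl⟩)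
  rw [eq_top_iff, ← TensorProduct.span_tmul_eq_top, Submodule.span_le]
  rintro _ ⟨a, b, rfl⟩
  exact tmul_mem a b

theorem eval_smul_of_mem_ruledJoinPiece (c : k) (v : X.cone) (w : Y.cone) {n : ℕ}
    {t : RuledJoinRing X Y} (ht : t ∈ ruledJoinPiece X Y n) :
    Y.evalAt ⟨c • w.1, Y.smul_mem_cone c w.2⟩
      (evalLeft X Y ⟨c • v.1, X.smul_mem_cone c v.2⟩ t) =
        c ^ n * Y.evalAt w (evalLeft X Y v t) := by
  induction ht using Submodule.span_induction with
  | mem t ht =>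
    obtain ⟨i, j, rfl, a, ha, b, hb, rfl⟩ := ht
    simp only [evalLeft_tmul, map_smul, smul_eq_mul, evalAt_smul X c v ha, evalAt_smul Y c w hb]
    ring
  | zero => simp
  | add x y _ _ hx hy => simp only [map_add, hx, hy, mul_add]
  | smul a x _ hx => simp only [map_smul, hx, smul_eq_mul, mul_left_comm]

section AlgClosed

variable [IsAlgClosed k]

theorem iSupIndep_ruledJoinPiece : iSupIndep (ruledJoinPiece X Y) := by
  refine (iSupIndep_iff_finsetSum_eq_zero_imp_eq_zero _).2 fun s t ht hsum n hn => ?_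
  refine eq_zero_of_eval X Y _ fun v w => ?_
  let q : Polynomial k := ∑ m ∈ s, Polynomial.monomial m (Y.evalAt w (evalLeft X Y v (t m)))
  have hq : q = 0 := Polynomial.funext fun c => by
    have := congrArg (fun x => Y.evalAt ⟨c • w.1, Y.smul_mem_cone c w.2⟩
      (evalLeft X Y ⟨c • v.1, X.smul_mem_cone c v.2⟩ x)) hsum
    simp only [map_sum, map_zero] at this
    simp only [q, Polynomial.eval_finsetSum, Polynomial.eval_monomial, Polynomial.eval_zero]
    rw [← this]
    refine Finset.sum_congr rfl fun m hm => ?_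
    rw [eval_smul_of_mem_ruledJoinPiece X Y c v w (ht m hm), mul_comm]
  have := congrArg (Polynomial.coeff · n) hq
  simpa [q, Polynomial.finsetSum_coeff, Polynomial.coeff_monomial, hn] using this

section Join

variable {ι : Type*} [Fintype ι] [Nonempty ι]

theorem mem_joinOfFamily_ideal_iff (Z : ι → ProjectiveVariety k N)
    (f : MvPolynomial (Fin (N + 1)) k) : f ∈ (joinOfFamily Z).ideal ↔
      ∀ c : ∀ i, (Z i).cone, MvPolynomial.aeval (∑ i, (c i).1) f = 0 := by
  refine ⟨fun h c => ?_, fun h =>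
    (mem_vanishingIdeal_spans_iff Z f).2 fun c hc _ => h fun i => ⟨c i, hc i⟩⟩
  by_cases h0 : ∑ i, (c i).1 = 0
  · obtain ⟨v, hv, _⟩ := (joinOfFamily Z).exists_cone_ne_zero
    rw [h0, ← zero_smul k v]
    exact (joinOfFamily Z).smul_mem_cone 0 hv f h
  · exact (mem_vanishingIdeal_spans_iff Z f).1 h _ (fun i => (c i).2) h0

theorem sum_mem_joinOfFamily_cone {Z : ι → ProjectiveVariety k N} (c : ∀ i, (Z i).cone) :
    ∑ i, (c i).1 ∈ (joinOfFamily Z).cone :=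
  fun f hf => (mem_joinOfFamily_ideal_iff Z f).1 hf c

theorem eq_zero_of_evalAt_sum (Z : ι → ProjectiveVariety k N) (a : (joinOfFamily Z).coordRing)
    (h : ∀ c : ∀ i, (Z i).cone,
      (joinOfFamily Z).evalAt ⟨∑ i, (c i).1, sum_mem_joinOfFamily_cone c⟩ a = 0) : a = 0 := by
  obtain ⟨f, rfl⟩ := toCoordRing_surjective _ a
  rw [toCoordRing_eq_zero_iff, mem_joinOfFamily_ideal_iff]
  exact h

end Join

theorem mem_embeddedJoin_ideal_iff (f : MvPolynomial (Fin (N + 1)) k) :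
    f ∈ (embeddedJoin X Y).ideal ↔
      ∀ (v : X.cone) (w : Y.cone), MvPolynomial.aeval (v.1 + w.1) f = 0 := by
  rw [embeddedJoin, mem_joinOfFamily_ideal_iff]
  refine ⟨fun h v w => ?_, fun h c => ?_⟩
  · have := h (Fin.cons v (Fin.cons w finZeroElim))
    rwa [Fin.sum_univ_two] at this
  · rw [Fin.sum_univ_two]
    exact h (c 0) (c 1)

theorem embeddedJoin_joinOfFamily {n : ℕ} [NeZero n] (Z : Fin n → ProjectiveVariety k N) :
    X.embeddedJoin (joinOfFamily Z) =
      joinOfFamily (Fin.cons X Z : Fin (n + 1) → ProjectiveVariety k N) := by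
  refine eq_of_ideal_eq (Ideal.ext fun f => ?_)
  have translate (v w : Fin (N + 1) → k) : MvPolynomial.aeval w (MvPolynomial.aeval
      (fun j => MvPolynomial.C (v j) + MvPolynomial.X j) f) = MvPolynomial.aeval (v + w) f := by
    rw [← AlgHom.comp_apply]
    congr 1
    ext j
    simp
  rw [mem_embeddedJoin_ideal_iff, mem_joinOfFamily_ideal_iff, Fin.forall_fin_succ_pi]
  refine forall_congr' fun v => ?_
  simp only [Fin.sum_univ_succ, ← translate]
  exact ⟨fun h c => h ⟨_, sum_mem_joinOfFamily_cone c⟩,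
    fun h w => w.2 _ ((mem_joinOfFamily_ideal_iff Z _).2 h)⟩

theorem embeddedJoin_secantVariety (r : ℕ) [NeZero r] :
    X.embeddedJoin (X.secantVariety r) = X.secantVariety (r + 1) := by
  have : (Fin.cons X fun _ : Fin r => X) = fun _ : Fin (r + 1) => X :=
    funext (Fin.cases rfl fun _ => rfl)
  rw [secantVariety, embeddedJoin_joinOfFamily, secantVariety, this]

end AlgClosed

end ProjectiveVariety

/-! ## Powers of the affine cone -/

namespace ProjectiveVariety

section ConePower

variable {k : Type*} [Field k] {N : ℕ} (X : ProjectiveVariety k N) (ι : Type*)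

/-- The coordinate ring of the power `C^ι` of the affine cone `C` over `X`, encoded as the ring of
polynomial functions on the `k`-points of `C^ι`. -/
def ConePowerRing : Subalgebra k ((ι → X.cone) → k) :=
  Algebra.adjoin k (Set.range fun p : ι × Fin (N + 1) => fun c => (c p.1).1 p.2)

variable {ι}

/-- The `j`-th coordinate of the `i`-th factor of the power of the cone. -/
def conePowerCoord (i : ι) (j : Fin (N + 1)) : X.ConePowerRing ι :=
  ⟨fun c => (c i).1 j, Algebra.subset_adjoin ⟨(i, j), rfl⟩⟩

@[simp]
theorem conePowerCoord_apply (i : ι) (j : Fin (N + 1)) (c : ι → X.cone) :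
    (X.conePowerCoord i j).1 c = (c i).1 j := rfl

instance [Finite ι] : Algebra.FiniteType k (X.ConePowerRing ι) :=
  (Subalgebra.fg_iff_finiteType _).1 (Subalgebra.fg_def.2 ⟨_, Set.finite_range _, rfl⟩)

theorem conePowerRing_algHom_ext {C : Type*} [CommRing C] [Algebra k C]
    {χ ψ : X.ConePowerRing ι →ₐ[k] C}
    (h : ∀ i j, χ (X.conePowerCoord i j) = ψ (X.conePowerCoord i j)) : χ = ψ := by
  refine AlgHom.adjoin_ext fun _ => ?_
  rintro ⟨⟨i, j⟩, rfl⟩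
  exact h i j

theorem comp_mem_conePowerRing (f : X.ConePowerRing ι) (τ : ι → ι) :
    (fun c => f.1 (c ∘ τ)) ∈ X.ConePowerRing ι := by
  have : X.ConePowerRing ι ≤ (X.ConePowerRing ι).comap (precompAlgHom k (· ∘ τ)) :=
    Algebra.adjoin_le fun _ ⟨(i, j), h⟩ => h ▸ (X.conePowerCoord (τ i) j).2
  exact this f.2

instance : MulSemiringAction (Equiv.Perm ι) (X.ConePowerRing ι) where
  smul σ f := ⟨fun c => f.1 (c ∘ σ), X.comp_mem_conePowerRing f σ⟩
  one_smul _ := rfl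
  mul_smul _ _ _ := rfl
  smul_zero _ := rfl
  smul_add _ _ _ := rfl
  smul_one _ := rfl
  smul_mul _ _ _ := rfl

@[simp]
theorem perm_smul_apply (σ : Equiv.Perm ι) (f : X.ConePowerRing ι) (c : ι → X.cone) :
    (σ • f).1 c = f.1 (c ∘ σ) := rfl

@[simp]
theorem perm_smul_conePowerCoord (σ : Equiv.Perm ι) (i : ι) (j : Fin (N + 1)) :
    σ • X.conePowerCoord i j = X.conePowerCoord (σ i) j := rfl

instance : SMulCommClass (Equiv.Perm ι) k (X.ConePowerRing ι) := ⟨fun _ _ _ => rfl⟩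

section Discriminant

/-- The minor of the coordinates `a`, `b` of the factors `i`, `l` of the power of the cone. -/
def minor (a b : Fin (N + 1)) (i l : ι) : X.ConePowerRing ι :=
  X.conePowerCoord i a * X.conePowerCoord l b - X.conePowerCoord i b * X.conePowerCoord l a

/-- The product of the minors of all pairs of factors. On the open set where it does not vanish,
the factors lie on distinct lines. -/
def discriminant [Fintype ι] [DecidableEq ι] (a b : Fin (N + 1)) : X.ConePowerRing ι :=
  ∏ p ∈ (Finset.univ : Finset ι).offDiag, X.minor a b p.1 p.2

variable {X}

theorem exists_cone_pair (hpos : X.points.Nontrivial) :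
    ∃ v w : X.cone, ∃ a b, v.1 a * w.1 b - v.1 b * w.1 a ≠ 0 := by
  obtain ⟨p, hp, q, hq, hpq⟩ := hpos
  refine ⟨⟨p.rep, hp⟩, ⟨q.rep, hq⟩, ?_⟩
  by_contra! h
  rw [← p.mk_rep, ← q.mk_rep] at hpq
  exact hpq (mk_eq_mk_of_forall_mul_eq_mul _ _ fun a b => sub_eq_zero.1 (h a b))

theorem exists_minor_ne_zero (hpos : X.points.Nontrivial) (ι : Type*) :
    ∃ a b, ∀ i l : ι, i ≠ l → X.minor a b i l ≠ 0 := by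
  classical
  obtain ⟨v, w, a, b, hab⟩ := exists_cone_pair hpos
  refine ⟨a, b, fun i l hil h => hab ?_⟩
  have := congrFun (congrArg Subtype.val h) (Function.update (fun _ => w) i v)
  simpa [minor, hil.symm] using this

theorem faithfulSMul_perm (hpos : X.points.Nontrivial) :
    FaithfulSMul (Equiv.Perm ι) (X.ConePowerRing ι) := by
  refine ⟨fun {σ τ} hστ => Equiv.ext fun i => ?_⟩
  obtain ⟨a, b, hab⟩ := exists_minor_ne_zero hpos ι
  by_contra hi
  refine hab _ _ hi ?_
  rw [minor, ← perm_smul_conePowerCoord X σ, ← perm_smul_conePowerCoord X σ, hστ, hστ,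
    perm_smul_conePowerCoord, perm_smul_conePowerCoord, mul_comm, sub_self]

variable [Fintype ι] [DecidableEq ι] {a b : Fin (N + 1)} {χ : X.ConePowerRing ι →ₐ[k] k}

theorem map_minor_ne_zero (hχ : χ (X.discriminant a b) ≠ 0) {i l : ι} (hil : i ≠ l) :
    χ (X.minor a b i l) ≠ 0 := by
  rw [discriminant, map_prod] at hχ
  exact Finset.prod_ne_zero_iff.1 hχ (i, l) (by simpa using hil)

theorem map_conePowerCoord_ne_zero [Nontrivial ι] (hχ : χ (X.discriminant a b) ≠ 0) (i : ι) :
    (fun j => χ (X.conePowerCoord i j)) ≠ 0 := by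
  intro h
  obtain ⟨l, hl⟩ := exists_ne i
  have hi : ∀ j, χ (X.conePowerCoord i j) = 0 := congrFun h
  exact map_minor_ne_zero hχ hl.symm (by simp [minor, hi])

theorem injective_mk_map_conePowerCoord [Nontrivial ι] (hχ : χ (X.discriminant a b) ≠ 0) :
    Function.Injective fun i => Projectivization.mk k (fun j => χ (X.conePowerCoord i j))
      (map_conePowerCoord_ne_zero hχ i) := by
  intro i l h
  by_contra hil
  obtain ⟨c, hc⟩ := (Projectivization.mk_eq_mk_iff' _ _ _ _ _).1 h
  have hcoord : ∀ j, χ (X.conePowerCoord i j) = c * χ (X.conePowerCoord l j) :=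
    fun j => (congrFun hc j).symm
  exact map_minor_ne_zero hχ hil (by simp only [minor, map_sub, map_mul, hcoord]; ring)

end Discriminant

section Morphism

variable {X} {Y : ProjectiveVariety k N}

theorem evalAt_mem_conePowerRing {F : (ι → X.cone) → Y.cone}
    (hF : ∀ j, (fun c => (F c).1 j) ∈ X.ConePowerRing ι) (a : Y.coordRing) :
    (fun c => Y.evalAt (F c) a) ∈ X.ConePowerRing ι := by
  have : Algebra.adjoin k (Set.range Y.coord) ≤
      (X.ConePowerRing ι).comap (AlgHom.pi fun c => Y.evalAt (F c)) := by
    refine Algebra.adjoin_le ?_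
    rintro _ ⟨j, rfl⟩
    change (fun c => Y.evalAt (F c) (Y.coord j)) ∈ X.ConePowerRing ι
    simpa only [evalAt_coord] using hF j
  exact this (Y.adjoin_range_coord ▸ Algebra.mem_top)

/-- The homomorphism of coordinate rings that corresponds to a polynomial map `F` from a power of
the cone over `X` to the cone over `Y`. -/
def conePowerComap (F : (ι → X.cone) → Y.cone)
    (hF : ∀ j, (fun c => (F c).1 j) ∈ X.ConePowerRing ι) : Y.coordRing →ₐ[k] X.ConePowerRing ι :=
  (AlgHom.pi fun c => Y.evalAt (F c)).codRestrict (X.ConePowerRing ι) (evalAt_mem_conePowerRing hF)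

@[simp]
theorem conePowerComap_apply (F : (ι → X.cone) → Y.cone)
    (hF : ∀ j, (fun c => (F c).1 j) ∈ X.ConePowerRing ι) (a : Y.coordRing) (c : ι → X.cone) :
    (conePowerComap F hF a).1 c = Y.evalAt (F c) a := rfl

variable (X) in
/-- The homomorphism of coordinate rings that corresponds to the projection onto the `i`-th factor
of a power of the cone over `X`. -/
def conePowerProj (i : ι) : X.coordRing →ₐ[k] X.ConePowerRing ι :=
  conePowerComap (fun c => c i) fun j => (X.conePowerCoord i j).2

@[simp]
theorem conePowerProj_apply (i : ι) (a : X.coordRing) (c : ι → X.cone) :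
    (X.conePowerProj i a).1 c = X.evalAt (c i) a := rfl

theorem conePowerProj_coord (i : ι) (j : Fin (N + 1)) :
    X.conePowerProj i (X.coord j) = X.conePowerCoord i j :=
  Subtype.ext (funext fun c => X.evalAt_coord (c i) j)

theorem map_conePowerCoord_mem_cone (χ : X.ConePowerRing ι →ₐ[k] k) (i : ι) :
    (fun j => χ (X.conePowerCoord i j)) ∈ X.cone := by
  simpa [conePowerProj_coord] using algHom_coord_mem_cone (χ.comp (X.conePowerProj i))

end Morphism

theorem update_mem_range_evalAt [DecidableEq ι] (f : X.ConePowerRing ι) (c : ι → X.cone) (i : ι) :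
    (fun v => f.1 (Function.update c i v)) ∈ (AlgHom.pi X.evalAt).range := by
  have : X.ConePowerRing ι ≤
      (AlgHom.pi X.evalAt).range.comap (precompAlgHom k (Function.update c i)) := by
    refine Algebra.adjoin_le ?_
    rintro _ ⟨⟨l, j⟩, rfl⟩
    rcases eq_or_ne l i with rfl | hli
    · exact ⟨X.coord j, funext fun v => by simp [precompAlgHom]⟩
    · exact ⟨algebraMap k _ ((c l).1 j), funext fun v => by simp [precompAlgHom, hli]⟩
  exact this f.2

variable [IsAlgClosed k]

instance [Finite ι] : IsDomain (X.ConePowerRing ι) := by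
  classical
  have hinj : Function.Injective (AlgHom.pi X.evalAt) :=
    (injective_iff_map_eq_zero _).2 fun a ha => X.eq_zero_of_evalAt a (congrFun ha)
  have hdom (p) (hp : p ∈ (AlgHom.pi X.evalAt).range) (q) (hq : q ∈ (AlgHom.pi X.evalAt).range)
      (hp0 : p ≠ 0) (hq0 : q ≠ 0) : p * q ≠ 0 := by
    obtain ⟨a, rfl⟩ := hp
    obtain ⟨b, rfl⟩ := hq
    have := mul_ne_zero ((map_ne_zero_iff _ hinj).1 hp0) ((map_ne_zero_iff _ hinj).1 hq0)
    exact map_mul (AlgHom.pi X.evalAt) a b ▸ (map_ne_zero_iff _ hinj).2 this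
  have : Nonempty X.cone := let ⟨v, hv, _⟩ := X.exists_cone_ne_zero; ⟨⟨v, hv⟩⟩
  have : NoZeroDivisors (X.ConePowerRing ι) := ⟨fun {f g} hfg => by
    by_contra! hne
    exact mul_ne_zero_of_forall_update_mem (fun _ => hdom) (X.update_mem_range_evalAt f)
      (X.update_mem_range_evalAt g) (Subtype.coe_ne_coe.2 hne.1) (Subtype.coe_ne_coe.2 hne.2)
      (congrArg Subtype.val hfg)⟩
  exact NoZeroDivisors.to_isDomain _

theorem discriminant_ne_zero [Fintype ι] [DecidableEq ι] {a b : Fin (N + 1)}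
    (hab : ∀ i l : ι, i ≠ l → X.minor a b i l ≠ 0) : X.discriminant (ι := ι) a b ≠ 0 :=
  Finset.prod_ne_zero_iff.2 fun _ hp => hab _ _ (by simpa using hp)

end ConePower

end ProjectiveVariety

/-! ## The degree of the join map -/

namespace ProjectiveVariety

section Degree

variable {k : Type*} [Field k] [IsAlgClosed k] {N : ℕ} {X : ProjectiveVariety k N}

section GeneralFibre

variable {ι : Type*} [Fintype ι] [Nontrivial ι]

theorem IsVeryAmple.exists_perm_forall_eq [DecidableEq ι] {d : ℕ} (hva : X.IsVeryAmple d)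
    (hemb : X.IsCompletelyEmbedded) (hι : Fintype.card ι + Fintype.card ι ≤ d + 1)
    {a b : Fin (N + 1)} {χ ψ : X.ConePowerRing ι →ₐ[k] k} (hχ : χ (X.discriminant a b) ≠ 0)
    (hψ : ψ (X.discriminant a b) ≠ 0)
    (hχψ : ∀ j, χ (∑ i, X.conePowerCoord i j) = ψ (∑ i, X.conePowerCoord i j)) :
    ∃ σ : Equiv.Perm ι, ∀ f, ψ f = χ (σ • f) := by
  obtain ⟨σ, hσ⟩ := hva.exists_perm_of_sum_eq hemb hι (map_conePowerCoord_mem_cone χ)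
    (map_conePowerCoord_mem_cone ψ) (map_conePowerCoord_ne_zero hχ)
    (map_conePowerCoord_ne_zero hψ) (injective_mk_map_conePowerCoord hχ)
    (injective_mk_map_conePowerCoord hψ) (funext fun j => by simpa using hχψ j)
  refine ⟨σ, DFunLike.congr_fun (g := χ.comp (MulSemiringAction.toAlgHom k _ σ)) ?_⟩
  exact conePowerRing_algHom_ext X fun i j => congrFun (hσ i) j

attribute [local instance] FractionRing.liftAlgebra in
theorem IsVeryAmple.finrank_fractionRing_conePowerRing [CharZero k] {d : ℕ}
    (hva : X.IsVeryAmple d) (hemb : X.IsCompletelyEmbedded) (hpos : X.points.Nontrivial)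
    (hι : Fintype.card ι + Fintype.card ι ≤ d + 1)
    (A : Type*) [CommRing A] [IsDomain A] [Algebra k A] [Algebra A (X.ConePowerRing ι)]
    [FaithfulSMul A (X.ConePowerRing ι)] [IsScalarTower k A (X.ConePowerRing ι)] (s : Set ι)
    [SMulCommClass (fixingSubgroup (Equiv.Perm ι) s) A (X.ConePowerRing ι)]
    (hsum : ∀ j, ∑ i, X.conePowerCoord i j ∈ (algebraMap A (X.ConePowerRing ι)).range)
    (hs : ∀ i ∈ s, ∀ j, X.conePowerCoord i j ∈ (algebraMap A (X.ConePowerRing ι)).range) :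
    Module.finrank (FractionRing A) (FractionRing (X.ConePowerRing ι)) =
      Nat.card (fixingSubgroup (Equiv.Perm ι) s) := by
  classical
  obtain ⟨a, b, hab⟩ := exists_minor_ne_zero hpos ι
  have := faithfulSMul_perm (ι := ι) hpos
  refine finrank_fractionRing_eq_card_of_fibres_subset_orbits (k := k)
    (fixingSubgroup (Equiv.Perm ι) s) (X.discriminant_ne_zero hab) fun χ ψ hχψ hχ hψ => ?_
  have eq_on_range {f} (hf : f ∈ (algebraMap A (X.ConePowerRing ι)).range) : χ f = ψ f := by
    obtain ⟨x, rfl⟩ := hf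
    exact hχψ x
  obtain ⟨σ, hσ⟩ := hva.exists_perm_forall_eq hemb hι hχ hψ fun j => eq_on_range (hsum j)
  have hσs (i) (hi : i ∈ s) : σ i = i := by
    refine injective_mk_map_conePowerCoord hχ ?_
    simp only [← perm_smul_conePowerCoord, ← hσ, eq_on_range (hs i hi _)]
  exact ⟨⟨σ, (mem_fixingSubgroup_iff _).2 hσs⟩, hσ⟩

end GeneralFibre

section Symmetrization

variable (X) (r : ℕ) [NeZero r]

/-- The map `C^(r+1) → cone(σ_r)`, `c ↦ -(c_1 + ⋯ + c_r)`, where `C` is the cone over `X`. The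
sign turns the differences in the rational map `J(X, σ_r) ⇢ σ_(r+1)` into sums. -/
def negSumTail (c : Fin (r + 1) → X.cone) : (X.secantVariety r).cone :=
  ⟨∑ i : Fin r, -(c i.succ).1,
    sum_mem_joinOfFamily_cone (Z := fun _ : Fin r => X)
      fun i => ⟨-(c i.succ).1, neg_mem_cone (c i.succ).2⟩⟩

theorem negSumTail_mem_conePowerRing (j : Fin (N + 1)) :
    (fun c => (X.negSumTail r c).1 j) ∈ X.ConePowerRing (Fin (r + 1)) := by
  have : (fun c => (X.negSumTail r c).1 j) = (-∑ i : Fin r, X.conePowerCoord i.succ j).1 :=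
    funext fun c => by simp [negSumTail]
  exact this ▸ (-∑ i : Fin r, X.conePowerCoord i.succ j).2

/-- The map `C^(r+1) → C × cone(σ_r)`, `c ↦ (c_0, -(c_1 + ⋯ + c_r))`, where `C` is the cone over
`X`, on coordinate rings. -/
def symmetrization : RuledJoinRing X (X.secantVariety r) →ₐ[k] X.ConePowerRing (Fin (r + 1)) :=
  Algebra.TensorProduct.lift (X.conePowerProj 0)
    (conePowerComap (X.negSumTail r) (X.negSumTail_mem_conePowerRing r)) fun _ _ => Commute.all _ _

theorem symmetrization_apply (t : RuledJoinRing X (X.secantVariety r))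
    (c : Fin (r + 1) → X.cone) : (X.symmetrization r t).1 c =
      (X.secantVariety r).evalAt (X.negSumTail r c) (evalLeft X (X.secantVariety r) (c 0) t) := by
  induction t using TensorProduct.induction_on with
  | zero => simp
  | add s t hs ht => simp_all
  | tmul a b => simp [symmetrization]

theorem symmetrization_injective : Function.Injective (X.symmetrization r) := by
  refine (injective_iff_map_eq_zero _).2 fun t ht => ?_
  refine eq_zero_of_evalLeft X _ t fun v => eq_zero_of_evalAt_sum _ _ fun c => ?_
  let d : Fin (r + 1) → X.cone := Fin.cons v fun i => ⟨-(c i).1, neg_mem_cone (c i).2⟩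
  have hd : X.negSumTail r d = ⟨∑ i, (c i).1, sum_mem_joinOfFamily_cone c⟩ := by
    simp [negSumTail, d]
  have := X.symmetrization_apply r t d
  rw [ht, hd] at this
  exact this.symm

theorem symmetrization_additionMap_apply (f : MvPolynomial (Fin (N + 1)) k)
    (c : Fin (r + 1) → X.cone) :
    (X.symmetrization r (additionMap X (X.secantVariety r) (toCoordRing _ f))).1 c =
      MvPolynomial.aeval (∑ i, (c i).1) f := by
  rw [symmetrization_apply]
  refine (eval_substDiff X (X.secantVariety r) _ _ f).trans ?_
  simp [negSumTail, Fin.sum_univ_succ]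

theorem perm_smul_symmetrization_additionMap (σ : Equiv.Perm (Fin (r + 1)))
    (a : (embeddedJoin X (X.secantVariety r)).coordRing) :
    σ • X.symmetrization r (additionMap X (X.secantVariety r) a) =
      X.symmetrization r (additionMap X (X.secantVariety r) a) := by
  obtain ⟨f, rfl⟩ := toCoordRing_surjective _ a
  refine Subtype.ext (funext fun c => ?_)
  rw [perm_smul_apply, symmetrization_additionMap_apply, symmetrization_additionMap_apply]
  exact congrArg (MvPolynomial.aeval · f) (Equiv.sum_comp σ fun i => (c i).1)

theorem perm_smul_symmetrization {σ : Equiv.Perm (Fin (r + 1))} (hσ : σ 0 = 0)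
    (t : RuledJoinRing X (X.secantVariety r)) :
    σ • X.symmetrization r t = X.symmetrization r t := by
  refine Subtype.ext (funext fun c => ?_)
  have htail : X.negSumTail r (c ∘ σ) = X.negSumTail r c := by
    have := Equiv.sum_comp σ fun i => (c i).1
    rw [Fin.sum_univ_succ, Fin.sum_univ_succ, hσ, add_right_inj] at this
    simpa [negSumTail] using this
  simp only [perm_smul_apply, symmetrization_apply, htail, Function.comp_apply, hσ]

theorem symmetrization_coord_tmul_one (j : Fin (N + 1)) :
    X.symmetrization r (X.coord j ⊗ₜ 1) = X.conePowerCoord 0 j :=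
  Subtype.ext (funext fun c => by simp [symmetrization_apply])

theorem symmetrization_additionMap_coord (j : Fin (N + 1)) :
    X.symmetrization r (additionMap X (X.secantVariety r) (coord _ j)) =
      ∑ i, X.conePowerCoord i j :=
  Subtype.ext (funext fun c => by simp [coord, symmetrization_additionMap_apply])

end Symmetrization

section Tower

variable (r : ℕ) [NeZero r]

local instance : Algebra (embeddedJoin X (X.secantVariety r)).coordRing
    (RuledJoinRing X (X.secantVariety r)) :=
  (additionMap X (X.secantVariety r)).toRingHom.toAlgebra

local instance : Algebra (RuledJoinRing X (X.secantVariety r)) (X.ConePowerRing (Fin (r + 1))) :=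
  (X.symmetrization r).toRingHom.toAlgebra

local instance : Algebra (embeddedJoin X (X.secantVariety r)).coordRing
    (X.ConePowerRing (Fin (r + 1))) :=
  ((X.symmetrization r).comp (additionMap X (X.secantVariety r))).toRingHom.toAlgebra

local instance : IsScalarTower k (embeddedJoin X (X.secantVariety r)).coordRing
    (RuledJoinRing X (X.secantVariety r)) :=
  .of_algHom (additionMap X (X.secantVariety r))

local instance : IsScalarTower k (RuledJoinRing X (X.secantVariety r))
    (X.ConePowerRing (Fin (r + 1))) :=
  .of_algHom (X.symmetrization r)

local instance : IsScalarTower k (embeddedJoin X (X.secantVariety r)).coordRing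
    (X.ConePowerRing (Fin (r + 1))) :=
  .of_algHom ((X.symmetrization r).comp (additionMap X (X.secantVariety r)))

local instance : IsScalarTower (embeddedJoin X (X.secantVariety r)).coordRing
    (RuledJoinRing X (X.secantVariety r)) (X.ConePowerRing (Fin (r + 1))) :=
  .of_algebraMap_eq fun _ => rfl

local instance : FaithfulSMul (embeddedJoin X (X.secantVariety r)).coordRing
    (RuledJoinRing X (X.secantVariety r)) :=
  (faithfulSMul_iff_algebraMap_injective _ _).2 (additionMap_injective X _)

local instance : FaithfulSMul (RuledJoinRing X (X.secantVariety r))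
    (X.ConePowerRing (Fin (r + 1))) :=
  (faithfulSMul_iff_algebraMap_injective _ _).2 (X.symmetrization_injective r)

local instance : FaithfulSMul (embeddedJoin X (X.secantVariety r)).coordRing
    (X.ConePowerRing (Fin (r + 1))) :=
  (faithfulSMul_iff_algebraMap_injective _ _).2
    ((X.symmetrization_injective r).comp (additionMap_injective X _))

-- Without this shortcut, the search for instances on the fraction field of this ring times out.
local instance : CommRing (X.ConePowerRing (Fin (r + 1))) := inferInstance

local instance : SMulCommClass (fixingSubgroup (Equiv.Perm (Fin (r + 1))) (∅ : Set (Fin (r + 1))))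
    (embeddedJoin X (X.secantVariety r)).coordRing (X.ConePowerRing (Fin (r + 1))) where
  smul_comm σ a f := by
    rw [Algebra.smul_def, Algebra.smul_def, smul_mul']
    exact congrArg (· * _) (X.perm_smul_symmetrization_additionMap r σ a)

local instance : SMulCommClass (fixingSubgroup (Equiv.Perm (Fin (r + 1))) {(0 : Fin (r + 1))})
    (RuledJoinRing X (X.secantVariety r)) (X.ConePowerRing (Fin (r + 1))) where
  smul_comm σ t f := by
    rw [Algebra.smul_def, Algebra.smul_def, smul_mul']
    exact congrArg (· * _)
      (X.perm_smul_symmetrization r ((mem_fixingSubgroup_iff _).1 σ.2 0 rfl) t)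

local instance : Nontrivial (Fin (r + 1)) :=
  Fin.nontrivial_iff_two_le.2 (Nat.succ_le_succ NeZero.one_le)

attribute [local instance] FractionRing.liftAlgebra

variable {r} [CharZero k]

theorem IsVeryAmple.finrank_embeddedJoin_conePowerRing (hva : X.IsVeryAmple (2 * r + 1))
    (hemb : X.IsCompletelyEmbedded) (hpos : X.points.Nontrivial) :
    Module.finrank (FractionRing (embeddedJoin X (X.secantVariety r)).coordRing)
      (FractionRing (X.ConePowerRing (Fin (r + 1)))) = Nat.card (Equiv.Perm (Fin (r + 1))) := by
  rw [hva.finrank_fractionRing_conePowerRing hemb hpos (by simp; omega)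
    (embeddedJoin X (X.secantVariety r)).coordRing ∅
    (fun j => ⟨_, X.symmetrization_additionMap_coord r j⟩) (by simp),
    fixingSubgroup_empty, Subgroup.card_top]

theorem IsVeryAmple.finrank_ruledJoinRing_conePowerRing (hva : X.IsVeryAmple (2 * r + 1))
    (hemb : X.IsCompletelyEmbedded) (hpos : X.points.Nontrivial) :
    Module.finrank (FractionRing (RuledJoinRing X (X.secantVariety r)))
      (FractionRing (X.ConePowerRing (Fin (r + 1)))) =
        Nat.card (MulAction.stabilizer (Equiv.Perm (Fin (r + 1))) (0 : Fin (r + 1))) := by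
  rw [hva.finrank_fractionRing_conePowerRing hemb hpos (by simp; omega)
    (RuledJoinRing X (X.secantVariety r)) {0} (fun j => ⟨_, X.symmetrization_additionMap_coord r j⟩)
    (fun i hi j => hi ▸ ⟨_, X.symmetrization_coord_tmul_one r j⟩)]
  congr! 2
  ext
  simp [mem_fixingSubgroup_iff]

theorem IsVeryAmple.joinDegree_secantVariety (hva : X.IsVeryAmple (2 * r + 1))
    (hemb : X.IsCompletelyEmbedded) (hpos : X.points.Nontrivial) :
    X.joinDegree (X.secantVariety r) = r + 1 := by
  obtain ⟨i, hi⟩ := (embeddedJoin X (X.secantVariety r)).exists_X_notMem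
  have degree_eq : X.joinDegree (X.secantVariety r) =
      Module.finrank (FractionRing (embeddedJoin X (X.secantVariety r)).coordRing)
        (FractionRing (RuledJoinRing X (X.secantVariety r))) :=
    GradedDomain.rationalMapDegree_eq_finrank (additionMap_mem X _) (iSup_piece _)
      (iSup_ruledJoinPiece X _) (iSupIndep_ruledJoinPiece X _) (coord_mem_piece _ i)
      (fun h => hi ((toCoordRing_eq_zero_iff _ _).1 h))
  have tower := finrank_fractionRing_mul_finrank_fractionRing
    (embeddedJoin X (X.secantVariety r)).coordRing (RuledJoinRing X (X.secantVariety r))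
    (X.ConePowerRing (Fin (r + 1)))
  rw [← degree_eq, hva.finrank_ruledJoinRing_conePowerRing hemb hpos,
    hva.finrank_embeddedJoin_conePowerRing hemb hpos,
    ← Subgroup.card_mul_index (MulAction.stabilizer (Equiv.Perm (Fin (r + 1))) (0 : Fin (r + 1))),
    MulAction.index_stabilizer_of_transitive, Nat.card_fin, mul_comm] at tower
  exact Nat.eq_of_mul_eq_mul_left Nat.card_pos tower

end Tower

end Degree

end ProjectiveVariety

end

theorem mainTheorem5_general {k : Type*} [Field k] [IsAlgClosed k] [CharZero k] {N : ℕ}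
    (X : ProjectiveVariety k N) (hpos : X.points.Nontrivial) (hemb : X.IsCompletelyEmbedded)
    {r : ℕ} [NeZero r] (hva : X.IsVeryAmple (2 * r + 1)) :
    X.embeddedJoin (X.secantVariety r) = X.secantVariety (r + 1) ∧
      X.joinDegree (X.secantVariety r) = r + 1 :=
  ⟨X.embeddedJoin_secantVariety r, hva.joinDegree_secantVariety hemb hpos⟩

theorem mainTheorem5 {k : Type*} [Field k] [IsAlgClosed k] [CharZero k] {N : ℕ}
    (X : ProjectiveVariety k N)
    (hpos : X.points.Nontrivial)
    (hns : X.IsNonsingular)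
    (hemb : X.IsCompletelyEmbedded)
    (hva : X.IsVeryAmple 5) :
    X.embeddedJoin (X.secantVariety 2) = X.secantVariety 3 ∧
      X.joinDegree (X.secantVariety 2) = 3 :=
  mainTheorem5_general X hpos hemb hva
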